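/- Let $p$ be a prime, $W=W(\overline{\mathbb F}_p)$ the ring of Witt vectors with Frobenius $F$, $K=\operatorname{Frac}W$, and let $q=4$ if $p=2$, $q=p$ if $p$ is odd. Let $s\ge 1$, let $a\in\mathbb Z_p\setminus\mathbb Z_{\le 0}$, let $c\in 1+qW$, and let $\sigma$ be the $p$-th Frobenius on $W[[t]]$ with $\sigma(t)=ct^p$, i.e. $\big(\sum_i a_it^i\big)^\sigma=\sum_i a_i^F c^i t^{ip}$. For $b\in\mathbb Z_p$ put $F_{b,\dots,b}(t)=\sum_{k\ge0}\left(\frac{(b)_k}{k!}\right)^s t^k$ ($s$ parameters), where $(b)_0=1$ and $(b)_k=b(b+1)\cdots(b+k-1)$. Let $a'=(a+l)/p$ with $l\in\{0,\dots,p-1\}$ the unique integer such that $a+l\equiv0\bmod p$; let $l'\in\{0,\dots,q-1\}$ be the unique integer with $a+l'\equiv 0\bmod q$ and $e=l'-\lfloor l'/p\rfloor$. Treat $t^\alpha$ ($\alpha\in\mathbb Z_p$) as formal symbols with $t^\alpha t^\beta=t^{\alpha+\beta}$, $\sigma(t^\alpha)=c^\alpha t^{p\alpha}$, where $c^\alpha=\sum_{i\ge0}\binom{\alpha}{i}(c-1)^i$,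 and $\int_0^t t^\alpha\frac{dt}{t}=\frac{t^\alpha}{\alpha}$ for $\alpha\ne0$. Define $$\widehat G^{(\sigma)}_{a,\dots,a}(t)=t^{-a}\int_0^t\Big(t^aF_{a,\dots,a}(t)-(-1)^{se}\big[t^{a'}F_{a',\dots,a'}(t)\big]^\sigma\Big)\frac{dt}{t},\qquad \widehat{\mathscr F}^{(\sigma)}_{a,\dots,a}(t)=\frac{\widehat G^{(\sigma)}_{a,\dots,a}(t)}{F_{a,\dots,a}(t)},$$ which are power series in $t$ with coefficients in $K$. For a power series $f(t)=\sum_k A_kt^k$ write $f(t)_{<m}=\sum_{k<m}A_kt^k$. **Theorem.** The series $\widehat G^{(\sigma)}_{a,\dots,a}(t)$ and $\widehat{\mathscr F}^{(\sigma)}_{a,\dots,a}(t)$ have coefficients in $W$, and for all integers $n\ge0$ $$\widehat{\mathscr F}^{(\sigma)}_{a,\dots,a}(t)\equiv\frac{\widehat G^{(\sigma)}_{a,\dots,a}(t)_{<p^n}}{F_{a,\dots,a}(t)_{<p^n}}\mod p^nW[[t]].$$ -/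

import Mathlib

open scoped PowerSeries

noncomputable section

namespace PadicHG

/-! Coefficient rings -/

/-- The ring of Witt vectors `W` of an algebraic closure of the field with `p` elements. -/
abbrev W (p : ℕ) [Fact p.Prime] : Type := WittVector p (AlgebraicClosure (ZMod p))

/-- The field of fractions `K` of `W`. -/
abbrev K (p : ℕ) [Fact p.Prime] : Type := FractionRing (W p)

variable (p : ℕ) [Fact p.Prime]

/-- The canonical embedding of the `p`-adic integers `ℤ_p = W(𝔽_p)` into `W`. -/
def zpToW : ℤ_[p] →+* W p :=
  (WittVector.map (algebraMap (ZMod p) (AlgebraicClosure (ZMod p)))).comp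
    (WittVector.equiv p).symm.toRingHom

/-- The canonical embedding of the `p`-adic integers into `K`. -/
def zpToK : ℤ_[p] →+* K p := (algebraMap (W p) (K p)).comp (zpToW p)

/-- The Frobenius automorphism of `K` induced by the Frobenius `F` of `W`. -/
def frobK : K p →+* K p :=
  (WittVector.FractionRing.frobenius p (AlgebraicClosure (ZMod p))).toRingHom

/-- `W⟦t⟧` inside `K⟦t⟧`. -/
def toK : (W p)⟦X⟧ →+* (K p)⟦X⟧ := PowerSeries.map (algebraMap (W p) (K p))

/-! Residues and the Dwork prime -/

/-- The integer `l ∈ {0, …, p ^ r - 1}` with `a + l ≡ 0 mod p ^ r`. -/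
def negResidue (a : ℤ_[p]) (r : ℕ) : ℕ := (-a).appr r

theorem negResidue_lt (a : ℤ_[p]) (r : ℕ) : negResidue p a r < p ^ r :=
  PadicInt.appr_lt _ _

theorem dvd_add_negResidue (a : ℤ_[p]) (r : ℕ) :
    (p : ℤ_[p]) ^ r ∣ a + (negResidue p a r : ℤ_[p]) := by
  have h := Ideal.mem_span_singleton.1 (PadicInt.appr_spec r (-a))
  have h2 := (dvd_neg).2 h
  have : -(-a - ((-a).appr r : ℤ_[p])) = a + (negResidue p a r : ℤ_[p]) := by
    unfold negResidue; ring
  rwa [this] at h2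

theorem exists_dworkPrime (a : ℤ_[p]) :
    ∃ b : ℤ_[p], a + (negResidue p a 1 : ℤ_[p]) = p * b := by
  obtain ⟨b, hb⟩ := dvd_add_negResidue p a 1
  exact ⟨b, by rw [hb, pow_one]⟩

/-- The Dwork prime `a' = (a + l) / p` where `l ∈ {0, …, p - 1}`, `a + l ≡ 0 mod p`. -/
def dworkPrime (a : ℤ_[p]) : ℤ_[p] := (exists_dworkPrime p a).choose

theorem mul_dworkPrime (a : ℤ_[p]) :
    (p : ℤ_[p]) * dworkPrime p a = a + (negResidue p a 1 : ℤ_[p]) :=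
  (exists_dworkPrime p a).choose_spec.symm

/-- The exponent of `p` in `q`. -/
def qExp : ℕ := if p = 2 then 2 else 1

/-- `q = 4` if `p = 2`, and `q = p` if `p` is odd. -/
def q : ℕ := p ^ qExp p

/-- `e = l' - ⌊l' / p⌋`, where `l' ∈ {0, …, q - 1}` is such that `a + l' ≡ 0 mod q`. -/
def e (a : ℤ_[p]) : ℕ := negResidue p a (qExp p) - negResidue p a (qExp p) / p

/-! Powers `c ^ α` for `c ∈ 1 + pW` and `α ∈ ℤ_p` -/

/-- `L` is the limit of the sequence `x` in the `p`-adic topology of `W`. -/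
def IsPadicLimit (x : ℕ → W p) (L : W p) : Prop :=
  ∀ n : ℕ, ∃ N : ℕ, ∀ m ≥ N, (p : W p) ^ n ∣ x m - L

/-- The partial sums of the binomial series `∑ i, binom(α, i) (c - 1) ^ i`. -/
def binomPartial (c : W p) (α : ℤ_[p]) (m : ℕ) : W p :=
  ∑ i ∈ Finset.range m, zpToW p (Ring.choose α i) * (c - 1) ^ i

theorem exists_binomLimit {c : W p} (hc : (p : W p) ∣ c - 1) (α : ℤ_[p]) :
    ∃ L : W p, IsPadicLimit p (binomPartial p c α) L := by
  have key : ∀ {m n : ℕ}, m ≤ n →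
      (p : W p) ^ m ∣ binomPartial p c α n - binomPartial p c α m := by
    intro m n hmn
    unfold binomPartial
    rw [← Finset.sum_range_add_sum_Ico _ hmn, add_sub_cancel_left]
    refine Finset.dvd_sum fun i hi => Dvd.dvd.mul_left ?_ _
    exact (pow_dvd_pow _ (Finset.mem_Ico.1 hi).1).trans (pow_dvd_pow_of_dvd hc i)
  obtain ⟨L, hL⟩ := IsPrecomplete.prec
    (inferInstance : IsPrecomplete (Ideal.span {(p : W p)}) (W p))
    (f := binomPartial p c α) (by
      intro m n hmn
      rw [SModEq.sub_mem, smul_eq_mul, Ideal.mul_top, Ideal.span_singleton_pow,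
        Ideal.mem_span_singleton, ← dvd_neg, neg_sub]
      exact key hmn)
  refine ⟨L, fun n => ⟨n, fun m hm => ?_⟩⟩
  have h := hL m
  rw [SModEq.sub_mem, smul_eq_mul, Ideal.mul_top, Ideal.span_singleton_pow,
    Ideal.mem_span_singleton] at h
  exact (pow_dvd_pow _ hm).trans h

theorem IsPadicLimit.unique {x : ℕ → W p} {L M : W p} (hL : IsPadicLimit p x L)
    (hM : IsPadicLimit p x M) : L = M := by
  rw [← sub_eq_zero]
  refine IsHausdorff.haus (inferInstance : IsHausdorff (Ideal.span {(p : W p)}) (W p)) _ ?_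
  intro n
  rw [SModEq.sub_mem, smul_eq_mul, Ideal.mul_top, Ideal.span_singleton_pow,
    Ideal.mem_span_singleton, sub_zero]
  obtain ⟨N, hN⟩ := hL n
  obtain ⟨N', hN'⟩ := hM n
  have h := dvd_sub (hN' _ (le_max_right N N')) (hN _ (le_max_left N N'))
  have e : x (max N N') - M - (x (max N N') - L) = L - M := by ring
  rwa [e] at h

open Classical in
/-- `c ^ α = ∑ i, binom(α, i) (c - 1) ^ i`, the sum taken `p`-adically; it converges for
`c ∈ 1 + pW`, and is only used for such `c` (the value is `0` if there is no limit). -/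
def padicPow (c : W p) (α : ℤ_[p]) : W p :=
  if h : ∃ L : W p, IsPadicLimit p (binomPartial p c α) L then h.choose else 0

theorem padicPow_spec {c : W p} (hc : (p : W p) ∣ c - 1) (α : ℤ_[p]) :
    IsPadicLimit p (binomPartial p c α) (padicPow p c α) := by
  have h := exists_binomLimit p hc α
  rw [padicPow, dif_pos h]
  exact h.choose_spec

/-! Formal series in the symbols `t ^ α`, `α ∈ ℤ_p`, with `t ^ α * t ^ β = t ^ (α + β)` -/

/-- The formal series `∑ x_α t ^ α` over `α ∈ ℤ_p` with coefficients in `K`, given by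
`α ↦ x_α`. -/
abbrev SymSeries : Type := ℤ_[p] → K p

/-- A power series `∑ x_k t ^ k` as a series in the symbols `t ^ α`. -/
def toSym (f : (K p)⟦X⟧) : SymSeries p :=
  Function.extend (fun k : ℕ => (k : ℤ_[p])) (fun k => PowerSeries.coeff k f) 0

/-- Multiplication by the symbol `t ^ β`. -/
def mulSym (β : ℤ_[p]) (x : SymSeries p) : SymSeries p := fun α => x (α - β)

/-- The Frobenius `σ(t) = c t ^ p`: it maps `∑ x_α t ^ α` to
`∑ F(x_α) c ^ α t ^ (p α)`. -/
def sigma (c : W p) (x : SymSeries p) : SymSeries p :=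
  Function.extend (fun α : ℤ_[p] => (p : ℤ_[p]) * α)
    (fun α => frobK p (x α) * algebraMap (W p) (K p) (padicPow p c α)) 0

/-- The operator `∫₀ᵗ (-) dt/t`, with `∫₀ᵗ t ^ α dt/t = t ^ α / α` for `α ≠ 0`; it is meant
for series whose coefficient of `t ^ 0` vanishes. -/
def integral (x : SymSeries p) : SymSeries p := fun α => x α / zpToK p α

/-! The hypergeometric functions -/

/-- The hypergeometric series `F_{a,…,a}(t) = ∑ k, ((a)_k / k!) ^ s t ^ k`, with `s`
parameters all equal to `a`. -/
def F (s : ℕ) (a : ℤ_[p]) : (K p)⟦X⟧ :=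
  PowerSeries.mk fun k =>
    ((ascPochhammer (K p) k).eval (zpToK p a) / (k.factorial : K p)) ^ s

/-- `t ^ a F_{a,…,a}(t) - (-1) ^ (s e) [t ^ a' F_{a',…,a'}(t)] ^ σ`. -/
def integrand (s : ℕ) (a : ℤ_[p]) (c : W p) : SymSeries p :=
  mulSym p a (toSym p (F p s a)) -
    (-1 : K p) ^ (s * e p a) •
      sigma p c (mulSym p (dworkPrime p a) (toSym p (F p s (dworkPrime p a))))

/-- `t ^ (-a) ∫₀ᵗ (t ^ a F_{a,…,a}(t) - (-1) ^ (s e) [t ^ a' F_{a',…,a'}(t)] ^ σ) dt/t`. -/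
def ghatSym (s : ℕ) (a : ℤ_[p]) (c : W p) : SymSeries p :=
  mulSym p (-a) (integral p (integrand p s a c))

/-- The series `ghatSym` as a power series in `t`; see `toSym_Ghat` for the fact that it has
no other terms. -/
def Ghat (s : ℕ) (a : ℤ_[p]) (c : W p) : (K p)⟦X⟧ :=
  PowerSeries.mk fun k => ghatSym p s a c (k : ℤ_[p])

/-- The `p`-adic hypergeometric function `Ghat / F`. The constant term of `F` is `1`. -/
def Fhat (s : ℕ) (a : ℤ_[p]) (c : W p) : (K p)⟦X⟧ := Ghat p s a c * (F p s a)⁻¹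

/-- The truncation `f(t)_{< m}` of a power series, again as a power series. -/
def truncLT (m : ℕ) (f : (K p)⟦X⟧) : (K p)⟦X⟧ := (PowerSeries.trunc m f : Polynomial (K p))

/-- `f ≡ g mod p ^ n W⟦t⟧`. -/
def CongrModPow (n : ℕ) (f g : (K p)⟦X⟧) : Prop :=
  ∃ h : (W p)⟦X⟧, f - g = toK p ((p : (W p)⟦X⟧) ^ n * h)

/-! The series above are well defined -/

theorem toSym_natCast (f : (K p)⟦X⟧) (k : ℕ) :
    toSym p f (k : ℤ_[p]) = PowerSeries.coeff k f :=
  Nat.cast_injective.extend_apply _ _ k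

theorem toSym_eq_zero (f : (K p)⟦X⟧) {α : ℤ_[p]} (h : ∀ k : ℕ, α ≠ k) : toSym p f α = 0 :=
  Function.extend_apply' _ _ _ fun ⟨k, hk⟩ => h k hk.symm

/-- The integrand only involves the symbols `t ^ (a + k)` with `k` a natural number. -/
theorem integrand_eq_zero (s : ℕ) (a : ℤ_[p]) (c : W p) {α : ℤ_[p]}
    (h : ∀ k : ℕ, α ≠ a + k) : integrand p s a c α = 0 := by
  have h1 : mulSym p a (toSym p (F p s a)) α = 0 :=
    toSym_eq_zero p _ fun k hk => h k (by rw [← hk]; ring)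
  have h2 : sigma p c (mulSym p (dworkPrime p a) (toSym p (F p s (dworkPrime p a)))) α = 0 := by
    unfold sigma
    have hp : (p : ℤ_[p]) ≠ 0 := Nat.cast_ne_zero.2 (Fact.out : p.Prime).ne_zero
    by_cases hα : ∃ β : ℤ_[p], (p : ℤ_[p]) * β = α
    · obtain ⟨β, rfl⟩ := hα
      rw [(mul_right_injective₀ hp).extend_apply]
      have : mulSym p (dworkPrime p a) (toSym p (F p s (dworkPrime p a))) β = 0 := by
        refine toSym_eq_zero p _ fun k hk => h (negResidue p a 1 + p * k) ?_
        have := mul_dworkPrime p a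
        have hβ : β = dworkPrime p a + k := by rw [← hk]; ring
        rw [hβ, mul_add, this]; push_cast; ring
      rw [this, map_zero, zero_mul]
    · exact Function.extend_apply' _ _ _ hα
  simp [integrand, h1, h2]

/-- For `a ∉ ℤ_{≤ 0}` the integrand has no term in `t ^ 0`, so it can be integrated. -/
theorem integrand_zero (s : ℕ) (a : ℤ_[p]) (c : W p) (ha : ∀ m : ℕ, a ≠ -(m : ℤ_[p])) :
    integrand p s a c 0 = 0 :=
  integrand_eq_zero p s a c fun k hk => ha k (eq_neg_of_add_eq_zero_left hk.symm)

/-- `ghatSym` is a power series in `t`, namely `Ghat`. -/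
theorem toSym_Ghat (s : ℕ) (a : ℤ_[p]) (c : W p) :
    toSym p (Ghat p s a c) = ghatSym p s a c := by
  funext α
  by_cases h : ∃ k : ℕ, α = k
  · obtain ⟨k, rfl⟩ := h
    rw [toSym_natCast, Ghat, PowerSeries.coeff_mk]
  · push Not at h
    rw [toSym_eq_zero p _ h]
    have : integrand p s a c (α - -a) = 0 :=
      integrand_eq_zero p s a c fun k hk => h k (by linear_combination hk)
    rw [ghatSym, mulSym, integral, this, zero_div]

end PadicHG

end

open scoped PowerSeries

noncomputable section

namespace PadicHG

/-! Weighted sums over residue classes -/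

/-! Put A_k = ((a)_k / k!)^s. Termwise integration gives `Ghat` the coefficients A_k β_k, where β_k
= 1/(a+k) if p does not divide a+k, and β_k = (1 - g_k^(-s) c^((a+k)/p)) / (a+k) otherwise. Here g_k
= `gammaQuot p a k` is the sign-corrected ratio of the prime-to-p parts of (a)_k and k!. After
multiplication by the two denominators, which are units of W⟦t⟧, the congruence says that p^n
divides every sum ∑_i β_i w_i with w_i = A_i A_(m-i) ([m-i < p^n] - [i < p^n]).

Two facts give this. First, β_k lies in W and β_(k+p^r) ≡ β_k mod p^r (`exists_mul_eq_ghatNum`,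
`pow_dvd_of_mul_eq_ghatNum`). Second, Dwork's congruences (`pow_dvd_sum_truncTerm`): the sum of the
w_i over a class modulo p^M is divisible by p^(n-M+1), and the full sum is 0 by antisymmetry.
Summation by parts along the tree of residue classes (`dvd_sum_modEq_mul`) combines them.

For the first fact, both g_k and c^((a+k)/p) have the form 1 + (a+k) b_k with b_k depending on k in
a Lipschitz way; this property survives products and inverses (`LipPair`). For the power of c it
follows from the divisibility of q^i / i!. For g_k, reversing the Pochhammer product gives ± ∏ (1 -
(a+k)/j) over j ≤ k prime to p, and the Lipschitz bound comes from translating a product of p^n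
consecutive terms, units only (`pow_mul_dvd_unitProd_add_sub`). At p = 2 this bound can fail by one
power of 2, and the sign (-1)^e compensates exactly.

The second fact is proved by induction on n, replacing a by a' through A_k = `dworkQuot p a k` ^ s ·
A'_⌊k/p⌋. -/

/-- Downward induction on M, splitting a class modulo p^M into classes modulo p^(M+1). Coarser
classes have a weaker bound on the variation of `h` but a stronger one on the sum of `w`. -/
theorem dvd_sum_modEq_sub_mul {R : Type*} [CommRing R] (π : R) (p m n δ : ℕ) (hp : 0 < p)
    (w h : ℕ → R)
    (hw : ∀ M ≤ n, ∀ c, π ^ (n - M + 1) ∣ ∑ i ∈ Finset.range (m + 1) with i ≡ c [MOD p ^ M], w i)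
    (hh : ∀ M ≤ n, ∀ i ≤ m, ∀ j ≤ m, i ≡ j [MOD p ^ M] → π ^ (M + δ) ∣ h i - h j)
    (M : ℕ) (hM : M ≤ n) : ∀ c ≤ m,
      π ^ (n + δ) ∣ ∑ i ∈ Finset.range (m + 1) with i ≡ c [MOD p ^ M], (h i - h c) * w i := by
  induction hM using Nat.decreasingInduction with
  | self =>
    intro c hc
    refine Finset.dvd_sum fun i hi => Dvd.dvd.mul_right ?_ _
    rw [Finset.mem_filter, Finset.mem_range] at hi
    exact hh n le_rfl i (by omega) c hc hi.2
  | of_succ M hM ih =>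
    intro c hc
    have hpos : 0 < p ^ (M + 1) := by positivity
    rw [← Finset.sum_fiberwise_of_maps_to (t := Finset.range (p ^ (M + 1)))
      (g := fun i => i % p ^ (M + 1)) fun i _ => Finset.mem_range.2 (Nat.mod_lt _ hpos)]
    refine Finset.dvd_sum fun d _ => ?_
    by_cases hex : ∃ j ≤ m, j ≡ c [MOD p ^ M] ∧ j % p ^ (M + 1) = d
    · obtain ⟨j, hj, hjc, rfl⟩ := hex
      have hset : ({i ∈ {i ∈ Finset.range (m + 1) | i ≡ c [MOD p ^ M]} |
          i % p ^ (M + 1) = j % p ^ (M + 1)} : Finset ℕ) =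
          {i ∈ Finset.range (m + 1) | i ≡ j [MOD p ^ (M + 1)]} := by
        ext i
        simp only [Finset.mem_filter, Finset.mem_range]
        constructor
        · rintro ⟨⟨h1, -⟩, h2⟩
          exact ⟨h1, h2⟩
        · rintro ⟨h1, h2⟩
          exact ⟨⟨h1, (Nat.ModEq.of_dvd (pow_dvd_pow p M.le_succ) h2).trans hjc⟩, h2⟩
      rw [hset]
      have hsplit : ∑ i ∈ Finset.range (m + 1) with i ≡ j [MOD p ^ (M + 1)], (h i - h c) * w i =
          (∑ i ∈ Finset.range (m + 1) with i ≡ j [MOD p ^ (M + 1)], (h i - h j) * w i) +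
          (h j - h c) * ∑ i ∈ Finset.range (m + 1) with i ≡ j [MOD p ^ (M + 1)], w i := by
        rw [Finset.mul_sum, ← Finset.sum_add_distrib]
        exact Finset.sum_congr rfl fun i _ => by ring
      rw [hsplit]
      refine dvd_add (ih j hj) ?_
      -- The exponents add up to (M + δ) + (n - (M + 1) + 1) = n + δ.
      have h1 := mul_dvd_mul (hh M hM.le j hj c hc hjc) (hw (M + 1) hM j)
      rw [← pow_add] at h1
      exact (pow_dvd_pow _ (by omega)).trans h1
    · rw [Finset.sum_eq_zero]
      · exact dvd_zero _
      · intro i hi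
        simp only [Finset.mem_filter, Finset.mem_range] at hi
        exact absurd ⟨i, by omega, hi.1.2, hi.2⟩ hex

theorem dvd_sum_modEq_mul {R : Type*} [CommRing R] (π : R) (p m n δ : ℕ) (hp : 0 < p)
    (w h : ℕ → R)
    (hw : ∀ M ≤ n, ∀ c, π ^ (n - M + 1) ∣ ∑ i ∈ Finset.range (m + 1) with i ≡ c [MOD p ^ M], w i)
    (hh : ∀ M ≤ n, ∀ i ≤ m, ∀ j ≤ m, i ≡ j [MOD p ^ M] → π ^ (M + δ) ∣ h i - h j)
    (M : ℕ) (hM : M ≤ n) (c N : ℕ) (hN : N ≤ n + δ)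
    (hc : π ^ N ∣ ∑ i ∈ Finset.range (m + 1) with i ≡ c [MOD p ^ M], w i) :
    π ^ N ∣ ∑ i ∈ Finset.range (m + 1) with i ≡ c [MOD p ^ M], h i * w i := by
  by_cases hex : ∃ j ≤ m, j ≡ c [MOD p ^ M]
  · obtain ⟨j, hj, hjc⟩ := hex
    have hset : ∀ i, i ≡ c [MOD p ^ M] ↔ i ≡ j [MOD p ^ M] :=
      fun i => ⟨fun h => h.trans hjc.symm, fun h => h.trans hjc⟩
    simp only [hset] at hc ⊢
    have hsplit : ∑ i ∈ Finset.range (m + 1) with i ≡ j [MOD p ^ M], h i * w i =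
        (∑ i ∈ Finset.range (m + 1) with i ≡ j [MOD p ^ M], (h i - h j) * w i) +
        h j * ∑ i ∈ Finset.range (m + 1) with i ≡ j [MOD p ^ M], w i := by
      rw [Finset.mul_sum, ← Finset.sum_add_distrib]
      exact Finset.sum_congr rfl fun i _ => by ring
    rw [hsplit]
    exact dvd_add ((pow_dvd_pow _ hN).trans
      (dvd_sum_modEq_sub_mul π p m n δ hp w h hw hh M hM j hj)) (hc.mul_left _)
  · rw [Finset.sum_eq_zero]
    · exact dvd_zero _
    · intro i hi
      simp only [Finset.mem_filter, Finset.mem_range] at hi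
      exact absurd ⟨i, by omega, hi.2⟩ hex

theorem dvd_sub_of_modEq_of_forall_dvd_add_sub {R : Type*} [CommRing R] (π : R) (h : ℕ → R)
    (d : ℕ) (hd : ∀ k, π ∣ h (k + d) - h k) {i j : ℕ} (hij : i ≡ j [MOD d]) :
    π ∣ h i - h j := by
  have key : ∀ k v, π ∣ h (k + d * v) - h k := by
    intro k v
    induction v with
    | zero => simp
    | succ v ih =>
      have := dvd_add (hd (k + d * v)) ih
      rwa [sub_add_sub_cancel, add_assoc, ← Nat.mul_succ] at this
  rcases le_total i j with hle | hle
  · obtain ⟨v, hv⟩ := (Nat.modEq_iff_dvd' hle).1 hij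
    obtain rfl : j = i + d * v := by omega
    rw [← dvd_neg, neg_sub]
    exact key i v
  · obtain ⟨v, hv⟩ := (Nat.modEq_iff_dvd' hle).1 hij.symm
    obtain rfl : i = j + d * v := by omega
    exact key j v

variable {p : ℕ} [hp : Fact p.Prime]

/-! Divisibility in `ℤ_p` -/

theorem isUnit_of_not_dvd {z : ℤ_[p]} (h : ¬(p : ℤ_[p]) ∣ z) : IsUnit z := by
  by_contra hz
  exact h ((PadicInt.norm_lt_one_iff_dvd z).1 (PadicInt.not_isUnit_iff.1 hz))

theorem not_dvd_of_isUnit {z : ℤ_[p]} (h : IsUnit z) : ¬(p : ℤ_[p]) ∣ z := fun hz =>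
  PadicInt.prime_p.not_isUnit (isUnit_of_dvd_unit hz h)

theorem pow_dvd_natCast_iff (n m : ℕ) : (p : ℤ_[p]) ^ n ∣ (m : ℤ_[p]) ↔ p ^ n ∣ m := by
  have := PadicInt.pow_p_dvd_int_iff (p := p) n (m : ℤ)
  rw [Int.cast_natCast] at this
  rw [this]
  exact_mod_cast Int.natCast_dvd_natCast

theorem dvd_natCast_iff (m : ℕ) : (p : ℤ_[p]) ∣ (m : ℤ_[p]) ↔ p ∣ m := by
  simpa using pow_dvd_natCast_iff (p := p) 1 m

theorem exists_natCast_pow_dvd_sub (z : ℤ_[p]) (n : ℕ) :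
    ∃ m : ℕ, (p : ℤ_[p]) ^ n ∣ z - m :=
  ⟨z.appr n, Ideal.mem_span_singleton.1 (PadicInt.appr_spec n z)⟩

theorem exists_eq_pow_mul_isUnit {z : ℤ_[p]} (hz : z ≠ 0) :
    ∃ (r : ℕ) (u : ℤ_[p]), IsUnit u ∧ z = (p : ℤ_[p]) ^ r * u :=
  ⟨z.valuation, PadicInt.unitCoeff hz, Units.isUnit _, by
    rw [mul_comm]; exact PadicInt.unitCoeff_spec hz⟩

theorem natCast_p_ne_zero : (p : ℤ_[p]) ≠ 0 := Nat.cast_ne_zero.2 hp.out.ne_zero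

/-- A function which is unchanged modulo `p ^ n` under `y ↦ y + 1` and which only depends on its
argument modulo `p ^ n` is constant modulo `p ^ n`. -/
theorem pow_dvd_sub_of_step (f : ℤ_[p] → ℤ_[p]) (n : ℕ)
    (h1 : ∀ y, (p : ℤ_[p]) ^ n ∣ f (y + 1) - f y)
    (h2 : ∀ y z, (p : ℤ_[p]) ^ n ∣ y - z → (p : ℤ_[p]) ^ n ∣ f y - f z) (y z : ℤ_[p]) :
    (p : ℤ_[p]) ^ n ∣ f y - f z := by
  have key : ∀ (m : ℕ), (p : ℤ_[p]) ^ n ∣ f (z + m) - f z := by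
    intro m
    induction m with
    | zero => simp
    | succ m ih =>
      have := dvd_add (h1 (z + m)) ih
      rwa [sub_add_sub_cancel, add_assoc, ← Nat.cast_succ] at this
  obtain ⟨m, hm⟩ := exists_natCast_pow_dvd_sub (y - z) n
  have := dvd_add (h2 y (z + m) (by rwa [← sub_sub])) (key m)
  rwa [sub_add_sub_cancel] at this

theorem exists_eq_one_add_two_mul {z : ℤ_[2]} (h : ¬(2 : ℤ_[2]) ∣ z) : ∃ t, z = 1 + 2 * t := by
  obtain ⟨m, t, ht⟩ := exists_natCast_pow_dvd_sub z 1
  rw [pow_one, Nat.cast_ofNat] at ht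
  have hm : ¬ 2 ∣ m := by
    rintro ⟨v, rfl⟩
    exact h ⟨t + v, by push_cast at ht; linear_combination ht⟩
  obtain ⟨v, rfl⟩ : ∃ v, m = 2 * v + 1 := ⟨m / 2, by omega⟩
  exact ⟨t + v, by push_cast at ht; linear_combination ht⟩

theorem isUnit_one_add_two_mul (t : ℤ_[2]) : IsUnit (1 + 2 * t) := by
  refine isUnit_of_not_dvd fun h => ?_
  rw [Nat.cast_ofNat] at h
  have h1 : ((2 : ℕ) : ℤ_[2]) ∣ 1 := by
    rw [Nat.cast_ofNat]
    exact (dvd_add_left (dvd_mul_right 2 t)).1 h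
  exact not_dvd_of_isUnit isUnit_one h1

theorem exists_eq_one_add_two_mul_of_isUnit {z : ℤ_[2]} (h : IsUnit z) :
    ∃ t, z = 1 + 2 * t :=
  exists_eq_one_add_two_mul (by simpa using not_dvd_of_isUnit h)

/-! The prime-to-`p` part of Pochhammer symbols -/

variable (p) in
open Classical in
/-- `z` if it is a unit and `1` otherwise. -/
def unitPart (z : ℤ_[p]) : ℤ_[p] := if (p : ℤ_[p]) ∣ z then 1 else z

variable (p) in
open Classical in
/-- The inverse of `z` if it is a unit and `0` otherwise. -/
def unitInv (z : ℤ_[p]) : ℤ_[p] := if (p : ℤ_[p]) ∣ z then 0 else Ring.inverse z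

variable (p) in
/-- The product of the units among `y, y + 1, …, y + M - 1`. -/
def unitProd (y : ℤ_[p]) (M : ℕ) : ℤ_[p] := ∏ i ∈ Finset.range M, unitPart p (y + i)

variable (p) in
/-- The sum of the inverses of the units among `y, y + 1, …, y + M - 1`. -/
def unitInvSum (y : ℤ_[p]) (M : ℕ) : ℤ_[p] := ∑ i ∈ Finset.range M, unitInv p (y + i)

theorem unitPart_of_dvd {z : ℤ_[p]} (h : (p : ℤ_[p]) ∣ z) : unitPart p z = 1 := if_pos h

theorem unitPart_of_not_dvd {z : ℤ_[p]} (h : ¬(p : ℤ_[p]) ∣ z) : unitPart p z = z := if_neg h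

theorem unitInv_of_dvd {z : ℤ_[p]} (h : (p : ℤ_[p]) ∣ z) : unitInv p z = 0 := if_pos h

theorem mul_unitInv {z : ℤ_[p]} (h : ¬(p : ℤ_[p]) ∣ z) : z * unitInv p z = 1 := by
  rw [unitInv, if_neg h]
  exact Ring.mul_inverse_cancel _ (isUnit_of_not_dvd h)

theorem isUnit_unitPart (z : ℤ_[p]) : IsUnit (unitPart p z) := by
  by_cases h : (p : ℤ_[p]) ∣ z
  · rw [unitPart_of_dvd h]; exact isUnit_one
  · rw [unitPart_of_not_dvd h]; exact isUnit_of_not_dvd h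

theorem isUnit_unitProd (y : ℤ_[p]) (M : ℕ) : IsUnit (unitProd p y M) :=
  IsUnit.prod_iff.2 fun _ _ => isUnit_unitPart _

theorem dvd_iff_dvd_of_pow_dvd_sub {y z : ℤ_[p]} {n : ℕ} (hn : n ≠ 0)
    (h : (p : ℤ_[p]) ^ n ∣ y - z) : (p : ℤ_[p]) ∣ y ↔ (p : ℤ_[p]) ∣ z :=
  dvd_iff_dvd_of_dvd_sub ((dvd_pow_self _ hn).trans h)

theorem pow_dvd_unitPart_sub {y z : ℤ_[p]} {n : ℕ} (hn : n ≠ 0)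
    (h : (p : ℤ_[p]) ^ n ∣ y - z) : (p : ℤ_[p]) ^ n ∣ unitPart p y - unitPart p z := by
  by_cases hy : (p : ℤ_[p]) ∣ y
  · rw [unitPart_of_dvd hy, unitPart_of_dvd ((dvd_iff_dvd_of_pow_dvd_sub hn h).1 hy), sub_self]
    exact dvd_zero _
  · rwa [unitPart_of_not_dvd hy,
      unitPart_of_not_dvd fun hz => hy ((dvd_iff_dvd_of_pow_dvd_sub hn h).2 hz)]

theorem pow_dvd_unitInv_sub {y z : ℤ_[p]} {n : ℕ} (hn : n ≠ 0)
    (h : (p : ℤ_[p]) ^ n ∣ y - z) : (p : ℤ_[p]) ^ n ∣ unitInv p y - unitInv p z := by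
  by_cases hy : (p : ℤ_[p]) ∣ y
  · rw [unitInv_of_dvd hy, unitInv_of_dvd ((dvd_iff_dvd_of_pow_dvd_sub hn h).1 hy), sub_self]
    exact dvd_zero _
  · have hz : ¬(p : ℤ_[p]) ∣ z := fun hz => hy ((dvd_iff_dvd_of_pow_dvd_sub hn h).2 hz)
    have : unitInv p y - unitInv p z = -(y - z) * (unitInv p y * unitInv p z) := by
      linear_combination unitInv p z * mul_unitInv hy - unitInv p y * mul_unitInv hz
    rw [this]
    exact ((dvd_neg).2 h).mul_right _

theorem unitProd_succ (y : ℤ_[p]) (M : ℕ) :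
    unitProd p y (M + 1) = unitProd p y M * unitPart p (y + M) := Finset.prod_range_succ _ _

theorem unitInvSum_succ (y : ℤ_[p]) (M : ℕ) :
    unitInvSum p y (M + 1) = unitInvSum p y M + unitInv p (y + M) := Finset.sum_range_succ _ _

theorem unitProd_add (y : ℤ_[p]) (M N : ℕ) :
    unitProd p y (M + N) = unitProd p y M * unitProd p (y + M) N := by
  unfold unitProd
  rw [Finset.prod_range_add]
  congr 1
  exact Finset.prod_congr rfl fun i _ => by push_cast; ring_nf

theorem unitInvSum_add (y : ℤ_[p]) (M N : ℕ) :
    unitInvSum p y (M + N) = unitInvSum p y M + unitInvSum p (y + M) N := by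
  unfold unitInvSum
  rw [Finset.sum_range_add]
  congr 1
  exact Finset.sum_congr rfl fun i _ => by push_cast; ring_nf

theorem unitProd_one (y : ℤ_[p]) : unitProd p y 1 = unitPart p y := by simp [unitProd]

theorem unitInvSum_one (y : ℤ_[p]) : unitInvSum p y 1 = unitInv p y := by simp [unitInvSum]

theorem pow_dvd_unitProd_sub_of_sub {y z : ℤ_[p]} {n : ℕ} (hn : n ≠ 0) (M : ℕ)
    (h : (p : ℤ_[p]) ^ n ∣ y - z) : (p : ℤ_[p]) ^ n ∣ unitProd p y M - unitProd p z M := by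
  induction M with
  | zero => simp [unitProd]
  | succ M ih =>
    rw [unitProd_succ, unitProd_succ]
    have h2 := pow_dvd_unitPart_sub hn (y := y + (M : ℤ_[p])) (z := z + (M : ℤ_[p])) (by simpa using h)
    have : unitProd p y M * unitPart p (y + M) - unitProd p z M * unitPart p (z + M) =
      (unitProd p y M - unitProd p z M) * unitPart p (y + M) +
        unitProd p z M * (unitPart p (y + M) - unitPart p (z + M)) := by ring
    rw [this]
    exact dvd_add (ih.mul_right _) (h2.mul_left _)

theorem pow_dvd_unitInvSum_sub_of_sub {y z : ℤ_[p]} {n : ℕ} (hn : n ≠ 0) (M : ℕ)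
    (h : (p : ℤ_[p]) ^ n ∣ y - z) : (p : ℤ_[p]) ^ n ∣ unitInvSum p y M - unitInvSum p z M := by
  unfold unitInvSum
  rw [← Finset.sum_sub_distrib]
  exact Finset.dvd_sum fun i _ => pow_dvd_unitInv_sub hn (by simpa using h)

/-- Moving the window one step trades the factor at y for the one at y + M, which agrees with it
modulo p^n. -/
theorem pow_dvd_unitProd_sub {n : ℕ} (hn : n ≠ 0) {M : ℕ} (hM : p ^ n ∣ M) (y z : ℤ_[p]) :
    (p : ℤ_[p]) ^ n ∣ unitProd p y M - unitProd p z M := by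
  refine pow_dvd_sub_of_step (fun y => unitProd p y M) n (fun y => ?_)
    (fun y z => pow_dvd_unitProd_sub_of_sub hn M) y z
  have h1 := unitProd_add y M 1
  have h2 := unitProd_add y 1 M
  rw [add_comm 1 M, h1, unitProd_one, unitProd_one, Nat.cast_one] at h2
  have h3 := pow_dvd_unitPart_sub hn (y := y + (M : ℤ_[p])) (z := y)
    (by simpa using (pow_dvd_natCast_iff n M).2 hM)
  refine ((isUnit_unitPart y).dvd_mul_left).1 ?_
  have : unitPart p y * (unitProd p (y + 1) M - unitProd p y M) =
      unitProd p y M * (unitPart p (y + M) - unitPart p y) := by linear_combination -h2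
  rw [this]
  exact h3.mul_left _

theorem pow_dvd_unitInvSum_sub {n : ℕ} (hn : n ≠ 0) {M : ℕ} (hM : p ^ n ∣ M) (y z : ℤ_[p]) :
    (p : ℤ_[p]) ^ n ∣ unitInvSum p y M - unitInvSum p z M := by
  refine pow_dvd_sub_of_step (fun y => unitInvSum p y M) n (fun y => ?_)
    (fun y z => pow_dvd_unitInvSum_sub_of_sub hn M) y z
  have h1 := unitInvSum_add y M 1
  have h2 := unitInvSum_add y 1 M
  rw [add_comm 1 M, h1, unitInvSum_one, unitInvSum_one, Nat.cast_one] at h2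
  have h3 := pow_dvd_unitInv_sub hn (y := y + (M : ℤ_[p])) (z := y)
    (by simpa using (pow_dvd_natCast_iff n M).2 hM)
  have : unitInvSum p (y + 1) M - unitInvSum p y M = unitInv p (y + M) - unitInv p y := by
    linear_combination -h2
  rwa [this]

theorem unitPart_add {y z : ℤ_[p]} (hz : (p : ℤ_[p]) ∣ z) :
    unitPart p (y + z) = unitPart p y * (1 + z * unitInv p y) := by
  by_cases hy : (p : ℤ_[p]) ∣ y
  · rw [unitPart_of_dvd hy, unitInv_of_dvd hy, unitPart_of_dvd (dvd_add hy hz)]; ring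
  · rw [unitPart_of_not_dvd hy, unitPart_of_not_dvd fun h => hy ((dvd_add_left hz).1 h)]
    linear_combination -z * mul_unitInv hy

theorem unitProd_add_eq_mul_prod {y z : ℤ_[p]} (hz : (p : ℤ_[p]) ∣ z) (M : ℕ) :
    unitProd p (y + z) M = unitProd p y M * ∏ i ∈ Finset.range M, (1 + z * unitInv p (y + i)) := by
  unfold unitProd
  rw [← Finset.prod_mul_distrib]
  exact Finset.prod_congr rfl fun i _ => by rw [add_right_comm, unitPart_add hz]

/-- First-order Taylor expansion: the logarithmic derivative of the product is the sum of inverses.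
-/
theorem unitProd_add_sub_modEq_sq {y z : ℤ_[p]} (hz : (p : ℤ_[p]) ∣ z) (M : ℕ) :
    ∃ t, unitProd p (y + z) M - unitProd p y M = unitProd p y M * (z * unitInvSum p y M + z ^ 2 * t) := by
  have key : ∃ t, ∏ i ∈ Finset.range M, (1 + z * unitInv p (y + i)) =
      1 + z * unitInvSum p y M + z ^ 2 * t := by
    induction M with
    | zero => exact ⟨0, by simp [unitInvSum]⟩
    | succ M ih =>
      obtain ⟨t, ht⟩ := ih
      rw [Finset.prod_range_succ, ht, unitInvSum_succ]
      exact ⟨t + unitInvSum p y M * unitInv p (y + M) + z * t * unitInv p (y + M), by ring⟩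
  obtain ⟨t, ht⟩ := key
  exact ⟨t, by rw [unitProd_add_eq_mul_prod hz, ht]; ring⟩

/-! ### Sums of inverses of units over blocks, with parities at p = 2 -/

theorem two_dvd_unitInv_sub_one {z : ℤ_[2]} (h : ¬(2 : ℤ_[2]) ∣ z) :
    (2 : ℤ_[2]) ∣ unitInv 2 z - 1 := by
  have h1 := mul_unitInv (p := 2) (z := z) (by simpa using h)
  obtain ⟨t, rfl⟩ := exists_eq_one_add_two_mul h
  exact ⟨-t * unitInv 2 (1 + 2 * t), by linear_combination h1⟩

theorem two_dvd_unitInvSum_two_mul_sub (y : ℤ_[2]) (m : ℕ) :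
    (2 : ℤ_[2]) ∣ unitInvSum 2 y (2 * m) - m := by
  induction m with
  | zero => simp [unitInvSum]
  | succ m ih =>
    rw [Nat.mul_succ, unitInvSum_succ, unitInvSum_succ]
    have key : (2 : ℤ_[2]) ∣ unitInv 2 (y + (2 * m : ℕ)) + unitInv 2 (y + (2 * m + 1 : ℕ)) - 1 := by
      by_cases hy : (2 : ℤ_[2]) ∣ y + (2 * m : ℕ)
      · rw [unitInv_of_dvd (by simpa using hy), zero_add]
        refine two_dvd_unitInv_sub_one fun h => ?_
        have h1 := dvd_sub h hy
        have : (y + (2 * m + 1 : ℕ) : ℤ_[2]) - (y + (2 * m : ℕ)) = 1 := by push_cast; ring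
        rw [this] at h1
        exact not_dvd_of_isUnit (p := 2) isUnit_one (by simpa using h1)
      · have h1 : (2 : ℤ_[2]) ∣ y + (2 * m + 1 : ℕ) := by
          obtain ⟨t, ht⟩ := exists_eq_one_add_two_mul hy
          exact ⟨1 + t, by push_cast at ht ⊢; linear_combination ht⟩
        rw [unitInv_of_dvd (z := y + ((2 * m + 1 : ℕ) : ℤ_[2])) (by simpa using h1), add_zero]
        exact two_dvd_unitInv_sub_one hy
    have := dvd_add ih key
    convert this using 1
    push_cast
    ring

/-- Pairing i with M - i, since 1/i + 1/(M - i) = M / (i (M - i)). -/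
theorem two_mul_unitInvSum_zero {M : ℕ} (hM : p ∣ M) :
    2 * unitInvSum p (0 : ℤ_[p]) M =
      M * ∑ i ∈ Finset.range M, unitInv p (i : ℤ_[p]) * unitInv p ((M : ℤ_[p]) - i) := by
  have h0 : unitInvSum p (0 : ℤ_[p]) M = ∑ i ∈ Finset.range M, unitInv p (i : ℤ_[p]) := by
    simp [unitInvSum]
  have hM' : (p : ℤ_[p]) ∣ (M : ℤ_[p]) := (dvd_natCast_iff M).2 hM
  have h1 : ∑ i ∈ Finset.range M, unitInv p (i : ℤ_[p]) =
      ∑ i ∈ Finset.range M, unitInv p ((M : ℤ_[p]) - i) := by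
    -- Adding the vanishing term i = M makes the range symmetric under i ↦ M - i.
    have e1 := Finset.sum_range_succ (fun i : ℕ => unitInv p (i : ℤ_[p])) M
    have e2 := Finset.sum_range_succ (fun i : ℕ => unitInv p ((M : ℤ_[p]) - i)) M
    rw [unitInv_of_dvd hM', add_zero] at e1
    rw [sub_self, unitInv_of_dvd (dvd_zero _), add_zero] at e2
    rw [← e1, ← e2, ← Finset.sum_range_reflect]
    refine Finset.sum_congr rfl fun i hi => ?_
    have : i ≤ M := by simpa [Nat.lt_succ_iff] using hi
    rw [show M + 1 - 1 - i = M - i by omega, Nat.cast_sub this]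
  rw [two_mul, h0]
  nth_rewrite 2 [h1]
  rw [← Finset.sum_add_distrib, Finset.mul_sum]
  refine Finset.sum_congr rfl fun i _ => ?_
  by_cases hi : (p : ℤ_[p]) ∣ i
  · rw [unitInv_of_dvd hi, unitInv_of_dvd (dvd_sub hM' hi)]; ring
  · have h2 : ¬(p : ℤ_[p]) ∣ (M : ℤ_[p]) - i := fun h => hi ((dvd_sub_right hM').1 h)
    linear_combination -(unitInv p (i : ℤ_[p])) * mul_unitInv h2 -
      unitInv p ((M : ℤ_[p]) - i) * mul_unitInv hi

theorem pow_dvd_unitInvSum {r : ℕ} (hr : r ≠ 0) (h : p ≠ 2 ∨ 2 ≤ r) {M : ℕ} (hM : p ^ r ∣ M)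
    (y : ℤ_[p]) : (p : ℤ_[p]) ^ r ∣ unitInvSum p y M := by
  have h0 : (p : ℤ_[p]) ^ r ∣ unitInvSum p 0 M := by
    have hpM : p ∣ M := (dvd_pow_self p hr).trans hM
    have hMr : (p : ℤ_[p]) ^ r ∣ (M : ℤ_[p]) := (pow_dvd_natCast_iff r M).2 hM
    have key := two_mul_unitInvSum_zero hpM
    by_cases hp2 : p = 2
    · subst hp2
      have hr2 : 2 ≤ r := by tauto
      obtain ⟨v, hv⟩ : 4 ∣ M := (pow_dvd_pow 2 hr2).trans hM
      -- The factor 2 on the left cannot be cancelled by a unit here. Modulo 2 all inverses of units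
      -- are 1, so this sum has the parity of the number of units below M, which is M/2, even
      -- because 4 divides M.
      have h2 : (2 : ℤ_[2]) ∣ ∑ i ∈ Finset.range M,
          unitInv 2 (i : ℤ_[2]) * unitInv 2 ((M : ℤ_[2]) - i) := by
        have e1 : (2 : ℤ_[2]) ∣ unitInvSum 2 0 M := by
          have := two_dvd_unitInvSum_two_mul_sub 0 (2 * v)
          rw [show 2 * (2 * v) = M by omega] at this
          have e : (2 : ℤ_[2]) ∣ ((2 * v : ℕ) : ℤ_[2]) := ⟨v, by push_cast; ring⟩
          simpa using dvd_add this e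
        have e2 : (2 : ℤ_[2]) ∣ ∑ i ∈ Finset.range M,
          unitInv 2 (i : ℤ_[2]) * unitInv 2 ((M : ℤ_[2]) - i) - unitInvSum 2 0 M := by
          unfold unitInvSum
          rw [← Finset.sum_sub_distrib]
          refine Finset.dvd_sum fun i _ => ?_
          rw [zero_add, ← mul_sub_one]
          by_cases hi : (2 : ℤ_[2]) ∣ i
          · rw [unitInv_of_dvd (by simpa using hi)]; simp
          · refine (two_dvd_unitInv_sub_one fun h => hi ((dvd_sub_right ?_).1 h)).mul_left _
            exact ⟨2 * v, by rw [hv]; push_cast; ring⟩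
        simpa using dvd_add e2 e1
      obtain ⟨s, hs⟩ := h2
      rw [hs] at key
      have : unitInvSum 2 (0 : ℤ_[2]) M = M * s := by
        have h2 : (2 : ℤ_[2]) ≠ 0 := two_ne_zero
        refine mul_left_cancel₀ h2 ?_
        linear_combination key
      rw [this]
      exact hMr.mul_right _
    · have h2 : IsUnit (2 : ℤ_[p]) := by
        refine isUnit_of_not_dvd fun h => hp2 ?_
        have := (dvd_natCast_iff (p := p) 2).1 (by simpa using h)
        exact (Nat.prime_dvd_prime_iff_eq hp.out Nat.prime_two).1 this
      rw [← h2.dvd_mul_left, key]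
      exact hMr.mul_right _
  have := dvd_add (pow_dvd_unitInvSum_sub hr hM y 0) h0
  rwa [sub_add_cancel] at this

/-! Translating the argument of `unitProd` -/

/-- Both ways of splitting a product of length m + N agree; this exchanges the roles of shift and
length. -/
theorem unitProd_swap (y : ℤ_[p]) (m N : ℕ) :
    unitProd p y m * (unitProd p (y + m) N - unitProd p y N) =
      unitProd p y N * (unitProd p (y + N) m - unitProd p y m) := by
  have h1 := unitProd_add y m N
  have h2 := unitProd_add y N m
  rw [add_comm N m, h1] at h2
  linear_combination h2

theorem pow_mul_dvd_unitProd_add_sub {n : ℕ} (hn : n ≠ 0) {y z : ℤ_[p]} (hz : (p : ℤ_[p]) ∣ z)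
    (hz0 : z ≠ 0) (h : p ≠ 2 ∨ 2 ≤ n ∧ (p : ℤ_[p]) ^ 2 ∣ z) :
    (p : ℤ_[p]) ^ n * z ∣ unitProd p (y + z) (p ^ n) - unitProd p y (p ^ n) := by
  obtain ⟨r, u, hu, hzu⟩ := exists_eq_pow_mul_isUnit hz0
  have hr2 : ∀ j, (p : ℤ_[p]) ^ j ∣ z → j ≤ r := fun j hj => by
    rw [hzu, hu.dvd_mul_right] at hj
    exact (pow_dvd_pow_iff natCast_p_ne_zero PadicInt.prime_p.not_isUnit).1 hj
  have hr : 1 ≤ r := hr2 1 (by simpa using hz)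
  rcases le_or_gt n r with hnr | hnr
  -- A highly divisible shift: p^n divides both the sum of inverses and z, so the two terms of the
  -- expansion suffice.
  · obtain ⟨t, ht⟩ := unitProd_add_sub_modEq_sq (y := y) hz (p ^ n)
    obtain ⟨v, hv⟩ := pow_dvd_unitInvSum hn (h.imp id And.left) dvd_rfl y
    obtain ⟨x, hx⟩ : (p : ℤ_[p]) ^ n ∣ z := by
      rw [hzu]; exact (pow_dvd_pow _ hnr).mul_right _
    rw [ht, hv]
    exact ⟨unitProd p y (p ^ n) * (v + x * t), by linear_combination unitProd p y (p ^ n) * z * t * hx⟩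
  -- Otherwise approximate z by a natural number m and swap: the shift becomes p^n and the length m,
  -- a multiple of p^r. The expansion then yields p^n · p^r and p^(2n), with r < n.
  · obtain ⟨m, hm⟩ := exists_natCast_pow_dvd_sub z (n + r)
    have hrz : (p : ℤ_[p]) ^ n * z = (p : ℤ_[p]) ^ (n + r) * u := by rw [hzu]; ring
    have hrm : (p : ℤ_[p]) ^ r ∣ (m : ℤ_[p]) := by
      have h1 : (p : ℤ_[p]) ^ r ∣ z := hzu ▸ dvd_mul_right _ _
      exact (dvd_sub_right h1).1 ((pow_dvd_pow _ (by omega)).trans hm)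
    have h1 := pow_dvd_unitProd_sub_of_sub (n := n + r) (y := y + z) (z := y + m) (by omega)
      (p ^ n) (by simpa using hm)
    have h2 : (p : ℤ_[p]) ^ (n + r) ∣ unitProd p (y + m) (p ^ n) - unitProd p y (p ^ n) := by
      rw [← (isUnit_unitProd y m).dvd_mul_left, unitProd_swap]
      obtain ⟨t, ht⟩ := unitProd_add_sub_modEq_sq (y := y) (z := (p ^ n : ℕ))
        (by push_cast; exact dvd_pow_self _ hn) m
      obtain ⟨v, hv⟩ := pow_dvd_unitInvSum (by omega) (h.imp id fun h => hr2 2 h.2)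
        ((pow_dvd_natCast_iff r m).1 hrm) y
      rw [ht, hv]
      refine Dvd.dvd.mul_left (Dvd.dvd.mul_left (dvd_add ⟨v, by push_cast; ring⟩ ?_) _) _
      refine Dvd.dvd.mul_right ?_ _
      push_cast
      rw [← pow_mul]
      exact pow_dvd_pow _ (by omega)
    have := dvd_add h1 h2
    rw [sub_add_sub_cancel] at this
    rw [hrz, hu.mul_right_dvd]
    exact this

/-- For a shift of 2-adic valuation exactly 1 the general bound p^n z fails by one factor of 2:
after the swap the length is twice an odd number, so the sum of inverses is odd. The exact leading
term is kept so that it can cancel later. -/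
theorem exists_unitProd_add_sub_eq_two_pow {n : ℕ} (hn : 2 ≤ n) (y : ℤ_[2]) {z : ℤ_[2]}
    (hz : IsUnit z) : ∃ t, unitProd 2 (y + 2 * z) (2 ^ n) - unitProd 2 y (2 ^ n) =
      2 ^ n * (1 + 2 * t) := by
  obtain ⟨m, hm⟩ := exists_natCast_pow_dvd_sub z n
  obtain ⟨x, hx⟩ := id hm
  have hmz : ¬ 2 ∣ m := by
    intro h
    rw [← dvd_natCast_iff (p := 2), ← dvd_iff_dvd_of_pow_dvd_sub (by omega) hm] at h
    exact not_dvd_of_isUnit hz h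
  obtain ⟨m', rfl⟩ : ∃ m', m = 2 * m' + 1 := ⟨m / 2, by omega⟩
  obtain ⟨t1, ht1⟩ := pow_dvd_unitProd_sub_of_sub (p := 2) (n := n + 1) (y := y + 2 * z)
    (z := y + (2 * (2 * m' + 1) : ℕ)) (by omega) (2 ^ n)
    ⟨x, by push_cast at hx ⊢; linear_combination 2 * hx⟩
  obtain ⟨t2, ht2⟩ := unitProd_add_sub_modEq_sq (p := 2) (y := y) (z := (2 ^ n : ℕ))
    (by push_cast; exact dvd_pow_self _ (by omega)) (2 * (2 * m' + 1))
  obtain ⟨t3, ht3⟩ := two_dvd_unitInvSum_two_mul_sub y (2 * m' + 1)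
  have hs := unitProd_swap y (2 * (2 * m' + 1)) (2 ^ n)
  rw [ht2] at hs
  have hs' : unitProd 2 (y + (2 * (2 * m' + 1) : ℕ)) (2 ^ n) - unitProd 2 y (2 ^ n) =
      unitProd 2 y (2 ^ n) * ((2 ^ n : ℕ) * unitInvSum 2 y (2 * (2 * m' + 1)) +
        ((2 ^ n : ℕ) : ℤ_[2]) ^ 2 * t2) := by
    refine (isUnit_unitProd y (2 * (2 * m' + 1))).mul_left_cancel ?_
    rw [hs]; ring
  obtain ⟨t4, ht4⟩ := exists_eq_one_add_two_mul_of_isUnit (isUnit_unitProd y (2 ^ n))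
  obtain ⟨j, rfl⟩ : ∃ j, n = j + 1 := ⟨n - 1, by omega⟩
  have ht3' : unitInvSum 2 y (2 * (2 * m' + 1)) = 1 + 2 * (m' + t3) := by
    push_cast at ht3; linear_combination ht3
  rw [ht3', ht4] at hs'
  have : unitProd 2 (y + 2 * z) (2 ^ (j + 1)) - unitProd 2 y (2 ^ (j + 1)) =
    2 ^ (j + 1 + 1) * t1 + (1 + 2 * t4) * (2 ^ (j + 1) * (1 + 2 * (m' + t3)) +
      (2 ^ (j + 1)) ^ 2 * t2) := by
    push_cast at ht1 hs' ht4 ⊢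
    linear_combination ht1 + hs' - ht4
  refine ⟨t1 + (m' + t3) + 2 ^ j * t2 + t4 * (1 + 2 * (m' + t3) + 2 ^ (j + 1) * t2), ?_⟩
  rw [this]
  ring

theorem exists_unitProd_two_add_sub_eq (y : ℤ_[2]) {z : ℤ_[2]} (hz : (2 : ℤ_[2]) ∣ z) :
    ∃ t, unitProd 2 (y + z) 2 - unitProd 2 y 2 = z * (1 + 2 * t) := by
  obtain ⟨t, ht⟩ := unitProd_add_sub_modEq_sq (p := 2) (y := y) (z := z) (by simpa using hz) 2
  obtain ⟨t3, ht3⟩ := two_dvd_unitInvSum_two_mul_sub y 1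
  obtain ⟨t4, ht4⟩ := exists_eq_one_add_two_mul_of_isUnit (isUnit_unitProd y 2)
  obtain ⟨x, rfl⟩ := hz
  rw [mul_one, Nat.cast_one, sub_eq_iff_eq_add] at ht3
  refine ⟨t3 + x * t + t4 * (1 + 2 * t3 + 2 * x * t), ?_⟩
  rw [ht, ht3, ht4]
  ring

theorem pow_dvd_natCast_sub_iff (n k l : ℕ) :
    (p : ℤ_[p]) ^ n ∣ (k : ℤ_[p]) - l ↔ k ≡ l [MOD p ^ n] := by
  have h := PadicInt.pow_p_dvd_int_iff (p := p) n ((k : ℤ) - l)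
  rw [Int.cast_sub, Int.cast_natCast, Int.cast_natCast] at h
  rw [h, Nat.ModEq.comm, Nat.modEq_iff_dvd, Nat.cast_pow]

/-! Quotients of shifted factorials without their factors divisible by `p` -/

variable (p) in
/-- The product of `1 - x / j` over the `j ≤ k` prime to `p`. -/
def unitQuot (k : ℕ) (x : ℤ_[p]) : ℤ_[p] := ∏ i ∈ Finset.range k, (1 - x * unitInv p (1 + i))

/-- As a function of x this is a polynomial with constant term 1, so its difference quotient `b` is
again a polynomial over ℤ_p. -/
theorem exists_unitQuot_eq (k : ℕ) : ∃ b : ℤ_[p] → ℤ_[p],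
    (∀ x, unitQuot p k x = 1 + x * b x) ∧ ∀ x y, x - y ∣ b x - b y := by
  induction k with
  | zero => exact ⟨0, by simp [unitQuot], by simp⟩
  | succ k ih =>
    obtain ⟨b, hb, hb'⟩ := ih
    refine ⟨fun x => b x - unitInv p (1 + k) * (1 + x * b x), fun x => ?_, fun x y => ?_⟩
    · have := hb x
      unfold unitQuot at this ⊢
      rw [Finset.prod_range_succ, this]
      ring
    · obtain ⟨t, ht⟩ := hb' x y
      exact ⟨t - unitInv p (1 + k) * (b x + y * t),
        by linear_combination (1 - unitInv p (1 + k) * y) * ht⟩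

/-- Since j (1 - z/j) = j - z, enlarging k becomes a translation of the argument of `unitProd` by
-z. -/
theorem unitQuot_add_mul_unitProd {z : ℤ_[p]} (hz : (p : ℤ_[p]) ∣ z) (k M : ℕ) :
    unitQuot p (k + M) z * unitProd p (1 + k) M =
      unitQuot p k z * unitProd p (1 + k + -z) M := by
  rw [unitProd_add_eq_mul_prod ((dvd_neg).2 hz), unitQuot, Finset.prod_range_add, unitQuot]
  have : ∏ i ∈ Finset.range M, (1 - z * unitInv p (1 + ((k + i : ℕ) : ℤ_[p]))) =
      ∏ i ∈ Finset.range M, (1 + -z * unitInv p (1 + k + i)) :=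
    Finset.prod_congr rfl fun i _ => by push_cast; ring_nf
  rw [this]
  ring

theorem prod_range_ite_dvd (k : ℕ) :
    ∏ i ∈ Finset.range k, (if p ∣ i + 1 then (1 : ℤ_[p]) else -1) = (-1) ^ (k - k / p) := by
  rw [Finset.prod_ite, Finset.prod_const_one, one_mul, Finset.prod_const]
  congr 1
  have h1 := Finset.card_filter_add_card_filter_not (s := Finset.range k) (fun i => p ∣ i + 1)
  rw [Nat.card_multiples, Finset.card_range] at h1
  omega

theorem unitPart_sub {x : ℤ_[p]} (hx : (p : ℤ_[p]) ∣ x) (j : ℕ) :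
    unitPart p (x - j) = (if p ∣ j then 1 else -1) *
      (unitPart p j * (1 - x * unitInv p j)) := by
  by_cases h : p ∣ j
  · have h' := (dvd_natCast_iff (p := p) j).2 h
    rw [if_pos h, unitPart_of_dvd h', unitPart_of_dvd (dvd_sub hx h'), unitInv_of_dvd h']
    ring
  · have h' := mt (dvd_natCast_iff (p := p) j).1 h
    rw [if_neg h, unitPart_of_not_dvd h', unitPart_of_not_dvd fun h => h' ((dvd_sub_right hx).1 h)]
    linear_combination -x * mul_unitInv h'

/-- Reading the product backwards writes its factors as (a + k) - j with 1 ≤ j ≤ k; each unit factor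
contributes one sign. -/
theorem unitProd_eq_mul_unitQuot {a : ℤ_[p]} {k : ℕ} (h : (p : ℤ_[p]) ∣ a + k) :
    unitProd p a k = (-1) ^ (k - k / p) * (unitProd p 1 k * unitQuot p k (a + k)) := by
  rw [unitProd, ← Finset.prod_range_reflect, ← prod_range_ite_dvd, unitProd, unitQuot,
    ← Finset.prod_mul_distrib, ← Finset.prod_mul_distrib]
  refine Finset.prod_congr rfl fun i hi => ?_
  have hi' : i + 1 ≤ k := Finset.mem_range.1 hi
  have h1 : a + ((k - 1 - i : ℕ) : ℤ_[p]) = a + k - ((i + 1 : ℕ) : ℤ_[p]) := by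
    rw [show k - 1 - i = k - (i + 1) by omega, Nat.cast_sub hi']
    ring
  have h2 : (1 + i : ℤ_[p]) = ((i + 1 : ℕ) : ℤ_[p]) := by push_cast; ring
  rw [h1, unitPart_sub h, h2]

/-! ### The sign-corrected quotient and its difference quotient in k -/

variable (p) in
/-- `(-1) ^ e` times the quotient of the prime-to-`p` parts of `(a)_k` and `k!`. -/
def gammaQuot (a : ℤ_[p]) (k : ℕ) : ℤ_[p] :=
  (-1) ^ e p a * (unitProd p a k * Ring.inverse (unitProd p 1 k))

theorem gammaQuot_eq {a : ℤ_[p]} {k : ℕ} (h : (p : ℤ_[p]) ∣ a + k) :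
    gammaQuot p a k = (-1) ^ (e p a + (k - k / p)) * unitQuot p k (a + k) := by
  rw [gammaQuot, unitProd_eq_mul_unitQuot h, pow_add]
  linear_combination ((-1) ^ e p a * (-1) ^ (k - k / p) * unitQuot p k (a + k)) *
    Ring.mul_inverse_cancel _ (isUnit_unitProd (1 : ℤ_[p]) k)

theorem modEq_negResidue {a : ℤ_[p]} {k r : ℕ} (h : (p : ℤ_[p]) ^ r ∣ a + k) :
    k ≡ negResidue p a r [MOD p ^ r] := by
  rw [← pow_dvd_natCast_sub_iff]
  have := dvd_sub h (dvd_add_negResidue p a r)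
  rwa [add_sub_add_left_eq_sub] at this

theorem mod_eq_negResidue {a : ℤ_[p]} {k r : ℕ} (h : (p : ℤ_[p]) ^ r ∣ a + k) :
    k % p ^ r = negResidue p a r := by
  rw [modEq_negResidue h, Nat.mod_eq_of_lt (negResidue_lt p a r)]

/-- The exponent `e` is chosen for this: k ≡ l' modulo q forces k - ⌊k/p⌋ ≡ e modulo 2. -/
theorem gammaQuot_eq_unitQuot {a : ℤ_[p]} {k : ℕ} (h : (p : ℤ_[p]) ^ qExp p ∣ a + k) :
    gammaQuot p a k = unitQuot p k (a + k) := by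
  have hq : qExp p ≠ 0 := by unfold qExp; split_ifs <;> simp
  rw [gammaQuot_eq ((dvd_pow_self _ hq).trans h), Even.neg_one_pow, one_mul]
  have hk := mod_eq_negResidue h
  unfold e
  rw [← hk]
  by_cases hp2 : p = 2
  · subst hp2
    have : qExp 2 = 2 := rfl
    rw [this, Nat.even_iff]
    have h2 : k / 2 = 2 * (k / 4) + k % 4 / 2 := by omega
    omega
  · have : qExp p = 1 := if_neg hp2
    rw [this, pow_one, Nat.div_eq_of_lt (Nat.mod_lt _ hp.out.pos), Nat.sub_zero]
    obtain ⟨w, hw⟩ := hp.out.odd_of_ne_two hp2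
    have h1 := Nat.div_add_mod k p
    have h2 : k - k / p = 2 * (w * (k / p)) + k % p := by
      have : p * (k / p) = 2 * (w * (k / p)) + k / p := by rw [hw]; ring
      omega
    rw [h2]
    exact ⟨k % p + w * (k / p), by ring⟩

/-- When a + k ≡ 2 modulo 4, k and l' differ by 2 modulo 4, which flips the parity of k - ⌊k/2⌋. -/
theorem gammaQuot_eq_neg_unitQuot {a : ℤ_[2]} {k : ℕ} (h : (2 : ℤ_[2]) ∣ a + k)
    (h4 : ¬(2 : ℤ_[2]) ^ 2 ∣ a + k) : gammaQuot 2 a k = -unitQuot 2 k (a + k) := by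
  rw [gammaQuot_eq (by simpa using h), Odd.neg_one_pow, neg_one_mul]
  have h1 : qExp 2 = 2 := rfl
  have hl := negResidue_lt 2 a 2
  have h2 : k ≡ negResidue 2 a 2 [MOD 2] := by
    have := dvd_sub h ((dvd_pow_self _ two_ne_zero).trans (dvd_add_negResidue 2 a 2))
    rw [add_sub_add_left_eq_sub] at this
    simpa using (pow_dvd_natCast_sub_iff (p := 2) 1 k (negResidue 2 a 2)).1 (by simpa using this)
  have h3 : ¬ k ≡ negResidue 2 a 2 [MOD 2 ^ 2] := by
    rw [← pow_dvd_natCast_sub_iff]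
    intro h
    have := dvd_add h (dvd_add_negResidue 2 a 2)
    exact h4 (by simpa [add_comm] using this)
  unfold e
  rw [h1, Nat.odd_iff]
  unfold Nat.ModEq at h2 h3
  omega

theorem isUnit_gammaQuot (a : ℤ_[p]) (k : ℕ) : IsUnit (gammaQuot p a k) :=
  (isUnit_neg_one.pow _).mul ((isUnit_unitProd a k).mul
    (isUnit_ringInverse.2 (isUnit_unitProd 1 k)))

theorem exists_gammaQuot_eq {a : ℤ_[p]} {k : ℕ} (h : (p : ℤ_[p]) ∣ a + k) :
    ∃ b, gammaQuot p a k = 1 + (a + k) * b := by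
  obtain ⟨b, hb, -⟩ := exists_unitQuot_eq (p := p) k
  by_cases h4 : (p : ℤ_[p]) ^ qExp p ∣ a + k
  · exact ⟨b (a + k), by rw [gammaQuot_eq_unitQuot h4, hb]⟩
  · by_cases hp2 : p = 2
    · subst hp2
      rw [Nat.cast_ofNat] at h h4
      obtain ⟨z, hz⟩ := id h
      have hz' : IsUnit z := by
        refine isUnit_of_not_dvd fun h => h4 ?_
        obtain ⟨v, rfl⟩ := h
        exact ⟨v, by rw [hz]; push_cast; simp [qExp]; ring⟩
      -- With a + k = 2z, the leading -1 is 1 - 2 = 1 - (a + k)/z.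
      refine ⟨-b (a + k) - Ring.inverse z, ?_⟩
      rw [gammaQuot_eq_neg_unitQuot h h4, hb]
      linear_combination 2 * Ring.mul_inverse_cancel z hz' + Ring.inverse z * hz
    · exact absurd (by simpa [qExp, hp2] using h) h4

/-- Comparison of the difference quotients of `unitQuot k` and `unitQuot (k + p ^ n)`. -/
theorem mul_unitQuot_sub {k M : ℕ} {z b b' : ℤ_[p]} (hz : (p : ℤ_[p]) ∣ z)
    (hb : unitQuot p k z = 1 + z * b) (hb' : unitQuot p (k + M) z = 1 + z * b') :
    unitProd p (1 + k) M * (z * (b' - b)) =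
      unitQuot p k z * (unitProd p (1 + k + -z) M - unitProd p (1 + k) M) := by
  have := unitQuot_add_mul_unitProd hz k M
  rw [hb'] at this
  linear_combination this + unitProd p (1 + k) M * hb

/-- The difference b' - b splits in two: changing k to k + p^n at the fixed point a + k + p^n,
controlled by the translation bound, and moving the point by p^n for fixed k, controlled by
polynomiality. -/
theorem pow_dvd_of_gammaQuot_eq_of_qExp_dvd {a : ℤ_[p]} {n k : ℕ} (hn : n ≠ 0)
    (hn2 : p ≠ 2 ∨ 2 ≤ n) (h : (p : ℤ_[p]) ^ qExp p ∣ a + k) (h0 : a + k ≠ 0)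
    (h0' : a + k + p ^ n ≠ 0) {b b' : ℤ_[p]} (hb : gammaQuot p a k = 1 + (a + k) * b)
    (hb' : gammaQuot p a (k + p ^ n) = 1 + (a + k + p ^ n) * b') : (p : ℤ_[p]) ^ n ∣ b' - b := by
  have hq : qExp p ≠ 0 := by unfold qExp; split_ifs <;> simp
  have hqn : qExp p ≤ n := by unfold qExp; split_ifs <;> [tauto; omega]
  have hz : (p : ℤ_[p]) ^ qExp p ∣ a + k + p ^ n := dvd_add h (pow_dvd_pow _ hqn)
  have hcast : a + ((k + p ^ n : ℕ) : ℤ_[p]) = a + k + p ^ n := by push_cast; ring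
  obtain ⟨β, hβ, hβ'⟩ := exists_unitQuot_eq (p := p) k
  rw [gammaQuot_eq_unitQuot h, hβ, add_right_inj, mul_right_inj' h0] at hb
  rw [gammaQuot_eq_unitQuot (by rwa [hcast]), hcast] at hb'
  have hpz := (dvd_pow_self _ hq).trans hz
  have key := mul_unitQuot_sub hpz (hβ _) hb'
  have h1 := pow_mul_dvd_unitProd_add_sub hn (y := 1 + (k : ℤ_[p])) ((dvd_neg).2 hpz)
    (neg_ne_zero.2 h0') (by
      refine or_iff_not_imp_left.2 fun h2 => ⟨by tauto, ?_⟩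
      rw [dvd_neg]
      have : qExp p = 2 := if_pos (not_not.1 h2)
      rwa [← this])
  rw [mul_neg, neg_dvd] at h1
  have h2 := key ▸ h1.mul_left (unitQuot p k (a + k + p ^ n))
  rw [(isUnit_unitProd _ _).dvd_mul_left, mul_comm, mul_dvd_mul_iff_left h0'] at h2
  have h3 := (hβ' (a + k + p ^ n) (a + k))
  rw [add_sub_cancel_left, hb] at h3
  simpa using dvd_add h2 h3

/-- With a + k = 2z and z' = z + 2^(n-1), the sign contributes 1/z - 1/z' = 2^(n-1)/(z z'), and the
translation defect is also 2^(n-1) times a unit. The two cancel modulo 2^n. -/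
theorem two_pow_dvd_of_gammaQuot_eq {a : ℤ_[2]} {n k : ℕ} (hn : 2 ≤ n)
    (h : (2 : ℤ_[2]) ∣ a + k) (h4 : ¬(2 : ℤ_[2]) ^ 2 ∣ a + k) {b b' : ℤ_[2]}
    (hb : gammaQuot 2 a k = 1 + (a + k) * b)
    (hb' : gammaQuot 2 a (k + 2 ^ n) = 1 + (a + k + 2 ^ n) * b') : (2 : ℤ_[2]) ^ n ∣ b' - b := by
  have hcast : a + ((k + 2 ^ n : ℕ) : ℤ_[2]) = a + k + 2 ^ n := by push_cast; ring
  obtain ⟨z, hz⟩ := id h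
  have hzu : ¬(2 : ℤ_[2]) ∣ z := by
    rintro ⟨v, rfl⟩
    exact h4 ⟨v, by rw [hz]; ring⟩
  obtain ⟨j, rfl⟩ : ∃ j, n = j + 1 := ⟨n - 1, by omega⟩
  have hz' : a + k + 2 ^ (j + 1) = 2 * (z + 2 ^ j) := by rw [hz]; ring
  have hzu' : ¬(2 : ℤ_[2]) ∣ z + 2 ^ j := fun hd =>
    hzu ((dvd_add_left (dvd_pow_self _ (by omega))).1 hd)
  have h' : (2 : ℤ_[2]) ∣ a + k + 2 ^ (j + 1) := ⟨_, hz'⟩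
  have h4' : ¬(2 : ℤ_[2]) ^ 2 ∣ a + k + 2 ^ (j + 1) := by
    rw [hz', pow_two, mul_dvd_mul_iff_left two_ne_zero]
    exact hzu'
  obtain ⟨β, hβ, hβ'⟩ := exists_unitQuot_eq (p := 2) k
  obtain ⟨β₁, hβ₁, -⟩ := exists_unitQuot_eq (p := 2) (k + 2 ^ (j + 1))
  rw [gammaQuot_eq_neg_unitQuot h h4, hβ, hz] at hb
  rw [gammaQuot_eq_neg_unitQuot (by rwa [hcast]) (by rwa [hcast]), hcast, hβ₁, hz'] at hb'
  have key := mul_unitQuot_sub (p := 2) (z := a + k + 2 ^ (j + 1)) (by simpa using h') (hβ _)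
    (hβ₁ _)
  have hunit : IsUnit (-(z + 2 ^ j)) :=
    (isUnit_of_not_dvd (p := 2) (by simpa using hzu')).neg
  obtain ⟨t, ht⟩ := exists_unitProd_add_sub_eq_two_pow hn (1 + (k : ℤ_[2])) hunit
  have hneg : (1 + k + 2 * -(z + 2 ^ j) : ℤ_[2]) = 1 + k + -(2 * (z + 2 ^ j)) := by ring
  rw [hz'] at key
  rw [hneg] at ht
  rw [ht, hβ] at key
  obtain ⟨u, hu⟩ := exists_eq_one_add_two_mul_of_isUnit
    (isUnit_unitProd (p := 2) (1 + (k : ℤ_[2])) (2 ^ (j + 1)))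
  obtain ⟨v, hv⟩ := hβ' (2 * (z + 2 ^ j)) (2 * z)
  obtain ⟨x, hx⟩ := exists_eq_one_add_two_mul hzu
  obtain ⟨x', hx'⟩ := exists_eq_one_add_two_mul hzu'
  have hb0 : z * b = -1 - z * β (2 * z) := by
    refine mul_left_cancel₀ (two_ne_zero (α := ℤ_[2])) ?_
    linear_combination -hb
  have hb0' : (z + 2 ^ j) * b' = -1 - (z + 2 ^ j) * β₁ (2 * (z + 2 ^ j)) := by
    refine mul_left_cancel₀ (two_ne_zero (α := ℤ_[2])) ?_
    linear_combination -hb'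
  have key0 : unitProd 2 (1 + (k : ℤ_[2])) (2 ^ (j + 1)) * ((z + 2 ^ j) *
      (β₁ (2 * (z + 2 ^ j)) - β (2 * (z + 2 ^ j)))) =
      (1 + 2 * (z + 2 ^ j) * β (2 * (z + 2 ^ j))) * (2 ^ j * (1 + 2 * t)) := by
    refine mul_left_cancel₀ (two_ne_zero (α := ℤ_[2])) ?_
    linear_combination key
  have hU := isUnit_unitProd (p := 2) (1 + (k : ℤ_[2])) (2 ^ (j + 1))
  generalize unitProd 2 (1 + (k : ℤ_[2])) (2 ^ (j + 1)) = U at *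
  generalize β₁ (2 * (z + 2 ^ j)) = B at *
  generalize β (2 * (z + 2 ^ j)) = B₀' at *
  generalize β (2 * z) = B₀ at *
  -- Clear the unit denominators U, z and z + 2^j before comparing.
  refine (((hU.mul (isUnit_of_not_dvd (p := 2) (by simpa using hzu))).mul
    (isUnit_of_not_dvd (p := 2) (by simpa using hzu'))).dvd_mul_left).1
    ⟨u - (x * (1 + 2 * t) + t + z * (z + 2 ^ j) * B₀' * (1 + 2 * t)) - U * z * (z + 2 ^ j) * v, ?_⟩
  linear_combination U * z * hb0' - U * (z + 2 ^ j) * hb0 - z * key0 - U * z * (z + 2 ^ j) * hv +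
    2 ^ j * hu - 2 ^ j * (1 + 2 * t) * hx

/-- Exactly one of a + k and a + k + 2 is divisible by 4, so one of the two quotients carries the
extra sign. Its odd contribution cancels the odd translation defect modulo 2. -/
theorem two_dvd_of_gammaQuot_eq {a : ℤ_[2]} {k : ℕ} (h : (2 : ℤ_[2]) ∣ a + k) (h0 : a + k ≠ 0)
    (h0' : a + k + 2 ≠ 0) {b b' : ℤ_[2]} (hb : gammaQuot 2 a k = 1 + (a + k) * b)
    (hb' : gammaQuot 2 a (k + 2) = 1 + (a + k + 2) * b') : (2 : ℤ_[2]) ∣ b' - b := by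
  have hcast : a + ((k + 2 : ℕ) : ℤ_[2]) = a + k + 2 := by push_cast; ring
  have h' : (2 : ℤ_[2]) ∣ a + k + 2 := dvd_add h dvd_rfl
  have hq : qExp 2 = 2 := rfl
  obtain ⟨z, hz⟩ := id h
  obtain ⟨β, hβ, hβ'⟩ := exists_unitQuot_eq (p := 2) k
  obtain ⟨β₁, hβ₁, -⟩ := exists_unitQuot_eq (p := 2) (k + 2)
  have key := mul_unitQuot_sub (p := 2) (z := a + k + 2) (by simpa using h') (hβ _) (hβ₁ _)
  obtain ⟨t, ht⟩ := exists_unitProd_two_add_sub_eq (1 + (k : ℤ_[2])) ((dvd_neg).2 h')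
  rw [ht, hβ] at key
  obtain ⟨v, hv⟩ := hβ' (a + k + 2) (a + k)
  have hU := isUnit_unitProd (p := 2) (1 + (k : ℤ_[2])) 2
  obtain ⟨u, hu⟩ := exists_eq_one_add_two_mul_of_isUnit hU
  have key0 : unitProd 2 (1 + (k : ℤ_[2])) 2 * (β₁ (a + k + 2) - β (a + k + 2)) =
      -(1 + (a + k + 2) * β (a + k + 2)) * (1 + 2 * t) := by
    refine mul_left_cancel₀ h0' ?_
    linear_combination key
  have hz' : a + k + 2 = 2 * (z + 1) := by rw [hz]; ring
  by_cases h4 : (2 : ℤ_[2]) ^ 2 ∣ a + k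
  · obtain ⟨y, rfl⟩ : (2 : ℤ_[2]) ∣ z := by
      rwa [hz, pow_two, mul_dvd_mul_iff_left two_ne_zero] at h4
    have h4' : ¬(2 : ℤ_[2]) ^ 2 ∣ a + k + 2 := by
      rw [hz', pow_two, mul_dvd_mul_iff_left two_ne_zero, add_comm]
      simpa using not_dvd_of_isUnit (isUnit_one_add_two_mul y)
    rw [gammaQuot_eq_unitQuot (by simpa [hq] using h4), hβ, add_right_inj, mul_right_inj' h0] at hb
    rw [gammaQuot_eq_neg_unitQuot (by rwa [hcast]) (by rwa [hcast]), hcast, hβ₁] at hb'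
    have hb0' : (2 * y + 1) * b' = -1 - (2 * y + 1) * β₁ (a + k + 2) := by
      refine mul_left_cancel₀ (two_ne_zero (α := ℤ_[2])) ?_
      linear_combination -hb' - (b' + β₁ (a + k + 2)) * hz'
    subst hb
    generalize unitProd 2 (1 + (k : ℤ_[2])) 2 = U at *
    generalize β₁ (a + k + 2) = B at *
    generalize β (a + k + 2) = B₀' at *
    generalize β (a + k) = B₀ at *
    have hyU : IsUnit (2 * y + 1) := by rw [add_comm]; exact isUnit_one_add_two_mul y
    refine ((hU.mul hyU).dvd_mul_left).1 ⟨-u + y + (2 * y + 1) * t +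
      (2 * y + 1) * (2 * y + 1) * B₀' * (1 + 2 * t) - (2 * y + 1) * U * (B₀ + v), ?_⟩
    linear_combination U * hb0' - (2 * y + 1) * key0 - (2 * y + 1) * U * hv - hu +
      (2 * y + 1) * B₀' * (1 + 2 * t) * hz'
  · have hzu : ¬(2 : ℤ_[2]) ∣ z := by
      rintro ⟨v, rfl⟩
      exact h4 ⟨v, by rw [hz]; ring⟩
    obtain ⟨x, rfl⟩ := exists_eq_one_add_two_mul hzu
    have h4' : (2 : ℤ_[2]) ^ 2 ∣ a + k + 2 := ⟨1 + x, by rw [hz']; ring⟩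
    rw [gammaQuot_eq_unitQuot (by rw [hcast]; simpa [hq] using h4'), hcast, hβ₁, add_right_inj,
      mul_right_inj' h0'] at hb'
    rw [gammaQuot_eq_neg_unitQuot h h4, hβ] at hb
    have hb0 : (1 + 2 * x) * b = -1 - (1 + 2 * x) * β (a + k) := by
      refine mul_left_cancel₀ (two_ne_zero (α := ℤ_[2])) ?_
      linear_combination -hb - (b + β (a + k)) * hz
    subst hb'
    generalize unitProd 2 (1 + (k : ℤ_[2])) 2 = U at *
    generalize β₁ (a + k + 2) = B at *
    generalize β (a + k + 2) = B₀' at *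
    generalize β (a + k) = B₀ at *
    refine ((hU.mul (isUnit_one_add_two_mul x)).dvd_mul_left).1 ⟨u - x - (1 + 2 * x) * t -
      (1 + 2 * x) * (2 + 2 * x) * B₀' * (1 + 2 * t) + (1 + 2 * x) * U * (B₀ + v), ?_⟩
    linear_combination -U * hb0 + (1 + 2 * x) * key0 + (1 + 2 * x) * U * hv + hu -
      (1 + 2 * x) * B₀' * (1 + 2 * t) * hz'

/-- The function `k ↦ (gammaQuot a k - 1) / (a + k)` is Lipschitz. -/
theorem pow_dvd_of_gammaQuot_eq {a : ℤ_[p]} {n k : ℕ} (hn : n ≠ 0)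
    (h : (p : ℤ_[p]) ∣ a + k) (h0 : a + k ≠ 0)
    (h0' : a + k + p ^ n ≠ 0) {b b' : ℤ_[p]} (hb : gammaQuot p a k = 1 + (a + k) * b)
    (hb' : gammaQuot p a (k + p ^ n) = 1 + (a + k + p ^ n) * b') : (p : ℤ_[p]) ^ n ∣ b' - b := by
  by_cases hp2 : p = 2
  · subst hp2
    rw [Nat.cast_ofNat] at *
    by_cases hn1 : n = 1
    · subst hn1
      rw [pow_one] at *
      exact two_dvd_of_gammaQuot_eq h h0 h0' hb hb'
    · by_cases h4 : (2 : ℤ_[2]) ^ 2 ∣ a + k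
      · simpa using pow_dvd_of_gammaQuot_eq_of_qExp_dvd (p := 2) hn (Or.inr (by omega))
          (by simpa [qExp] using h4) h0 (by simpa using h0') hb (by simpa using hb')
      · exact two_pow_dvd_of_gammaQuot_eq (by omega) h h4 hb hb'
  · exact pow_dvd_of_gammaQuot_eq_of_qExp_dvd hn (Or.inl hp2) (by simpa [qExp, hp2] using h) h0 h0'
      hb hb'

/-! Dwork's congruences for `(a)_k / k!` -/

theorem factorial_mul_multichoose (a : ℤ_[p]) (k : ℕ) :
    (k.factorial : ℤ_[p]) * Ring.multichoose a k = (ascPochhammer ℤ_[p] k).eval a := by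
  rw [← nsmul_eq_mul, Ring.factorial_nsmul_multichoose_eq_ascPochhammer,
    Polynomial.ascPochhammer_smeval_eq_eval]

theorem dvd_add_natCast_iff (a : ℤ_[p]) (k : ℕ) :
    (p : ℤ_[p]) ∣ a + k ↔ k % p = negResidue p a 1 := by
  constructor
  · intro h
    simpa using mod_eq_negResidue (r := 1) (by simpa using h)
  · intro h
    have h1 := dvd_add_negResidue p a 1
    rw [← h, pow_one] at h1
    have h2 : (k : ℤ_[p]) = p * (k / p : ℕ) + (k % p : ℕ) := by
      exact_mod_cast (Nat.div_add_mod k p).symm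
    rw [h2, add_left_comm]
    exact dvd_add (dvd_mul_right _ _) h1

theorem add_natCast_eq_mul {a : ℤ_[p]} {k : ℕ} (h : k % p = negResidue p a 1) :
    a + k = p * (dworkPrime p a + (k / p : ℕ)) := by
  have h2 : (k : ℤ_[p]) = p * (k / p : ℕ) + (k % p : ℕ) := by
    exact_mod_cast (Nat.div_add_mod k p).symm
  rw [mul_add, mul_dworkPrime, ← h]
  linear_combination h2

/-- The multiples of p among a, …, a + k - 1 are p (a' + j); there are ⌊k/p⌋ of them, plus one if
the last incomplete block passes the residue l. -/
theorem ascPochhammer_eval_eq (a : ℤ_[p]) (k : ℕ) :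
    (ascPochhammer ℤ_[p] k).eval a = unitProd p a k *
      ((p : ℤ_[p]) ^ (k / p + if k % p ≤ negResidue p a 1 then 0 else 1) *
        (ascPochhammer ℤ_[p] (k / p + if k % p ≤ negResidue p a 1 then 0 else 1)).eval
          (dworkPrime p a)) := by
  have hl : negResidue p a 1 < p := by simpa using negResidue_lt p a 1
  induction k with
  | zero => simp [unitProd]
  | succ k ih =>
    rw [ascPochhammer_succ_eval, ih, unitProd_succ]
    have hkp := Nat.mod_lt k hp.out.pos
    have hdm := Nat.div_add_mod k p
    have hdm' : k = k % p + p * (k / p) := by omega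
    have hstep : (k % p + 1 < p ∧ (k + 1) / p = k / p ∧ (k + 1) % p = k % p + 1) ∨
        (k % p + 1 = p ∧ (k + 1) / p = k / p + 1 ∧ (k + 1) % p = 0) := by
      rcases Nat.lt_or_ge (k % p + 1) p with h | h
      · left
        have e1 : k + 1 = (k % p + 1) + p * (k / p) := by omega
        refine ⟨h, ?_, ?_⟩
        · rw [e1, Nat.add_mul_div_left _ _ hp.out.pos, Nat.div_eq_of_lt h, zero_add]
        · nth_rewrite 1 [e1]
          rw [Nat.add_mul_mod_self_left, Nat.mod_eq_of_lt h]
      · right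
        have e1 : k + 1 = p * (k / p + 1) := by rw [mul_add]; omega
        refine ⟨by omega, ?_, ?_⟩
        · rw [e1, Nat.mul_div_cancel_left _ hp.out.pos]
        · rw [e1, Nat.mul_mod_right]
    by_cases h : k % p = negResidue p a 1
    · have hN : ((k + 1) / p + if (k + 1) % p ≤ negResidue p a 1 then 0 else 1) = k / p + 1 := by
        rcases hstep with ⟨h1, h2, h3⟩ | ⟨h1, h2, h3⟩
        · rw [h2, h3, if_neg (by omega)]
        · rw [h2, h3, if_pos (by omega)]
      rw [hN, if_pos h.le, add_zero, ascPochhammer_succ_eval,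
        unitPart_of_dvd ((dvd_add_natCast_iff a k).2 h), add_natCast_eq_mul h]
      ring
    · have hN : ((k + 1) / p + if (k + 1) % p ≤ negResidue p a 1 then 0 else 1) =
          k / p + if k % p ≤ negResidue p a 1 then 0 else 1 := by
        rcases hstep with ⟨h1, h2, h3⟩ | ⟨h1, h2, h3⟩
        · rw [h2, h3]
          split_ifs <;> omega
        · rw [h2, h3, if_pos (by omega), if_neg (by omega)]
      rw [hN, unitPart_of_not_dvd (mt (dvd_add_natCast_iff a k).1 h)]
      ring

theorem factorial_eq_unitProd_mul (k : ℕ) :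
    (k.factorial : ℤ_[p]) = unitProd p 1 k * ((p : ℤ_[p]) ^ (k / p) * ((k / p).factorial)) := by
  have h1 : negResidue p (1 : ℤ_[p]) 1 = p - 1 := by
    rw [← (dvd_add_natCast_iff (1 : ℤ_[p]) (p - 1)).1
      (by rw [Nat.cast_sub hp.out.one_le]; simp), Nat.mod_eq_of_lt (Nat.sub_lt hp.out.pos one_pos)]
  have h2 : dworkPrime p 1 = 1 := by
    refine mul_left_cancel₀ (natCast_p_ne_zero (p := p)) ?_
    rw [mul_dworkPrime, h1, Nat.cast_sub hp.out.one_le]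
    simp
  have := ascPochhammer_eval_eq (1 : ℤ_[p]) k
  rwa [h1, if_pos (Nat.le_sub_one_of_lt (Nat.mod_lt k hp.out.pos)), add_zero, h2,
    ascPochhammer_eval_one, ascPochhammer_eval_one] at this

variable (p) in
/-- The quotient of `(a)_k / k!` by `(a')_m / m!`, where `m = ⌊k / p⌋`. -/
def dworkQuot (a : ℤ_[p]) (k : ℕ) : ℤ_[p] :=
  unitProd p a k * Ring.inverse (unitProd p 1 k) *
    if k % p ≤ negResidue p a 1 then 1 else p * (dworkPrime p a + (k / p : ℕ))

theorem multichoose_eq_dworkQuot_mul (a : ℤ_[p]) (k : ℕ) :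
    Ring.multichoose a k = dworkQuot p a k * Ring.multichoose (dworkPrime p a) (k / p) := by
  have h1 := factorial_mul_multichoose a k
  have h2 := factorial_mul_multichoose (dworkPrime p a) (k / p)
  rw [ascPochhammer_eval_eq, factorial_eq_unitProd_mul] at h1
  have hinv := Ring.mul_inverse_cancel _ (isUnit_unitProd (1 : ℤ_[p]) k)
  have h0 : (p : ℤ_[p]) ^ (k / p) * ((k / p).factorial : ℤ_[p]) ≠ 0 :=
    mul_ne_zero (pow_ne_zero _ natCast_p_ne_zero) (Nat.cast_ne_zero.2 (Nat.factorial_ne_zero _))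
  refine (isUnit_unitProd (1 : ℤ_[p]) k).mul_left_cancel (mul_left_cancel₀ h0 ?_)
  unfold dworkQuot
  split_ifs at h1 ⊢ with h
  · rw [add_zero, ← h2] at h1
    linear_combination h1 - (p ^ (k / p) * ((k / p).factorial : ℤ_[p])) * unitProd p a k *
      Ring.multichoose (dworkPrime p a) (k / p) * hinv
  · rw [ascPochhammer_succ_eval, ← h2] at h1
    linear_combination h1 - (p ^ (k / p) * ((k / p).factorial : ℤ_[p])) * unitProd p a k *
      Ring.multichoose (dworkPrime p a) (k / p) * (p * (dworkPrime p a + (k / p : ℕ))) * hinv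

theorem pow_dvd_dworkQuot_add_sub (a : ℤ_[p]) {n : ℕ} (hn : n ≠ 0) (k : ℕ) :
    (p : ℤ_[p]) ^ n ∣ dworkQuot p a (k + p ^ n) - dworkQuot p a k := by
  obtain ⟨j, rfl⟩ : ∃ j, n = j + 1 := ⟨n - 1, by omega⟩
  have hmod : (k + p ^ (j + 1)) % p = k % p := by
    rw [pow_succ, mul_comm, Nat.add_mul_mod_self_left]
  have hdiv : (k + p ^ (j + 1)) / p = k / p + p ^ j := by
    rw [pow_succ, mul_comm, Nat.add_mul_div_left _ _ hp.out.pos]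
  have hT : (p : ℤ_[p]) ^ (j + 1) ∣ (if k % p ≤ negResidue p a 1 then 1 else
      (p : ℤ_[p]) * (dworkPrime p a + (k / p + p ^ j : ℕ))) -
      if k % p ≤ negResidue p a 1 then 1 else (p : ℤ_[p]) * (dworkPrime p a + (k / p : ℕ)) := by
    split_ifs
    · simp
    · exact ⟨1, by push_cast; ring⟩
  have h1 := Ring.mul_inverse_cancel _ (isUnit_unitProd (1 : ℤ_[p]) k)
  have h2 := Ring.mul_inverse_cancel _ (isUnit_unitProd (1 : ℤ_[p]) (k + p ^ (j + 1)))
  -- Multiplying by the unit denominators leaves a comparison of two blocks of length p^n, starting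
  -- at a + k and at 1 + k.
  rw [← ((isUnit_unitProd (1 : ℤ_[p]) k).mul
    (isUnit_unitProd (1 + k : ℤ_[p]) (p ^ (j + 1)))).dvd_mul_left]
  unfold dworkQuot
  rw [hmod, hdiv]
  generalize (if k % p ≤ negResidue p a 1 then 1 else
      (p : ℤ_[p]) * (dworkPrime p a + (k / p + p ^ j : ℕ))) = T' at *
  generalize (if k % p ≤ negResidue p a 1 then 1 else
      (p : ℤ_[p]) * (dworkPrime p a + (k / p : ℕ))) = T at *
  obtain ⟨t, ht⟩ := hT
  obtain ⟨t', ht'⟩ := pow_dvd_unitProd_sub hn (dvd_refl (p ^ (j + 1))) (a + k) (1 + k : ℤ_[p])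
  generalize Ring.inverse (unitProd p 1 (k + p ^ (j + 1))) = I' at *
  rw [unitProd_add] at h2
  rw [unitProd_add]
  refine ⟨unitProd p a k * (t' * T' + unitProd p (1 + k) (p ^ (j + 1)) * t), ?_⟩
  linear_combination unitProd p a k * unitProd p (a + k) (p ^ (j + 1)) * T' * h2 -
    unitProd p a k * T * unitProd p (1 + k) (p ^ (j + 1)) * h1 +
    unitProd p a k * T' * ht' + unitProd p a k * unitProd p (1 + k) (p ^ (j + 1)) * ht

theorem pow_dvd_dworkQuot_sub (a : ℤ_[p]) {n : ℕ} (hn : n ≠ 0) {i j : ℕ}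
    (hij : i ≡ j [MOD p ^ n]) : (p : ℤ_[p]) ^ n ∣ dworkQuot p a i - dworkQuot p a j :=
  dvd_sub_of_modEq_of_forall_dvd_add_sub _ _ _ (pow_dvd_dworkQuot_add_sub a hn) hij

/-- The summands of the coefficient of `t ^ m` in `F * F_{< p ^ n} - F_{< p ^ n} * F`, where
`F = F_{a,…,a}`. -/
def truncTerm (s : ℕ) (a : ℤ_[p]) (n m i : ℕ) : ℤ_[p] :=
  Ring.multichoose a i ^ s * Ring.multichoose a (m - i) ^ s *
    ((if m - i < p ^ n then 1 else 0) - if i < p ^ n then 1 else 0)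

theorem sum_truncTerm (s : ℕ) (a : ℤ_[p]) (n m : ℕ) :
    ∑ i ∈ Finset.range (m + 1), truncTerm s a n m i = 0 := by
  have h1 := Finset.sum_range_reflect (fun i => Ring.multichoose a i ^ s *
    Ring.multichoose a (m - i) ^ s * if i < p ^ n then (1 : ℤ_[p]) else 0) (m + 1)
  simp only [truncTerm, mul_sub, Finset.sum_sub_distrib]
  rw [sub_eq_zero, ← h1]
  refine Finset.sum_congr rfl fun i hi => ?_
  have hi' : i ≤ m := Nat.lt_succ_iff.1 (Finset.mem_range.1 hi)
  rw [Nat.add_sub_cancel, Nat.sub_sub_self hi']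
  ring

/-- Induction on n, for all a at once. In a class modulo p^(M+1) both i and m - i have fixed last
digits; removing them turns the sum into one for a', n and M, weighted by Lipschitz factors. -/
theorem pow_dvd_sum_truncTerm (s n : ℕ) : ∀ (a : ℤ_[p]) (m M : ℕ), M ≤ n → ∀ c,
    (p : ℤ_[p]) ^ (n - M + 1) ∣
      ∑ i ∈ Finset.range (m + 1) with i ≡ c [MOD p ^ M], truncTerm s a n m i := by
  induction n with
  | zero =>
    intro a m M hM c
    obtain rfl : M = 0 := by omega
    simp [Nat.modEq_one, sum_truncTerm]
  | succ n ih =>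
    intro a m M hM c
    rcases M with - | M
    · simp [Nat.modEq_one, sum_truncTerm]
    have hp0 := hp.out.pos
    by_cases hmc : m < c % p
    · rw [Finset.sum_eq_zero]
      · exact dvd_zero _
      · intro i hi
        simp only [Finset.mem_filter, Finset.mem_range] at hi
        have h1 : i % p = c % p := Nat.ModEq.of_dvd (dvd_pow_self p (Nat.succ_ne_zero M)) hi.2
        have := Nat.mod_le i p
        omega
    · push Not at hmc
      have hcp := Nat.mod_lt c hp0
      have hm := Nat.div_add_mod (m - c % p) p
      set m' := (m - c % p) / p with hm'
      set c' := (m - c % p) % p with hc'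
      have hc'p : c' < p := Nat.mod_lt _ hp0
      set h : ℕ → ℤ_[p] := fun u => dworkQuot p a (c % p + p * u) ^ s *
        dworkQuot p a (c' + p * (m' - u)) ^ s with hh
      have hsum : ∑ i ∈ Finset.range (m + 1) with i ≡ c [MOD p ^ (M + 1)],
          truncTerm s a (n + 1) m i = ∑ u ∈ Finset.range (m' + 1) with u ≡ c / p [MOD p ^ M],
          h u * truncTerm s (dworkPrime p a) n m' u := by
        symm
        refine Finset.sum_bij (fun u _ => c % p + p * u) ?_ ?_ ?_ ?_
        · intro u hu
          simp only [Finset.mem_filter, Finset.mem_range] at hu ⊢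
          constructor
          · have : p * u ≤ p * m' := Nat.mul_le_mul_left p (by omega)
            omega
          · have h1 := (hu.2.mul_left' p).add_left (c % p)
            rwa [← pow_succ', Nat.mod_add_div] at h1
        · intro u _ v _ huv
          exact Nat.eq_of_mul_eq_mul_left hp0 (Nat.add_left_cancel huv)
        · intro i hi
          simp only [Finset.mem_filter, Finset.mem_range] at hi
          have h1 : i % p = c % p := Nat.ModEq.of_dvd (dvd_pow_self p (Nat.succ_ne_zero M)) hi.2
          have h2 := Nat.mod_add_div i p
          refine ⟨i / p, ?_, by rw [← h1, h2]⟩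
          simp only [Finset.mem_filter, Finset.mem_range]
          constructor
          · rw [Nat.lt_succ_iff, hm', Nat.le_div_iff_mul_le hp0, mul_comm]
            omega
          · have h3 := hi.2
            rw [← h2, ← Nat.mod_add_div c p, h1, pow_succ'] at h3
            exact (Nat.ModEq.add_left_cancel' _ h3).mul_left_cancel' hp0.ne'
        · intro u hu
          simp only [Finset.mem_filter, Finset.mem_range] at hu
          have hu' : p * u ≤ p * m' := Nat.mul_le_mul_left p (by omega)
          have e1 : m - (c % p + p * u) = c' + p * (m' - u) := by
            rw [Nat.mul_sub]
            omega
          have e2 : (c % p + p * u) / p = u := by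
            rw [Nat.add_mul_div_left _ _ hp0, Nat.div_eq_of_lt hcp, zero_add]
          have e3 : (c' + p * (m' - u)) / p = m' - u := by
            rw [Nat.add_mul_div_left _ _ hp0, Nat.div_eq_of_lt hc'p, zero_add]
          have e4 : ∀ x d, d < p → (d + p * x < p ^ (n + 1) ↔ x < p ^ n) := by
            intro x d hd
            rw [pow_succ, ← Nat.div_lt_iff_lt_mul hp0, Nat.add_mul_div_left _ _ hp0,
              Nat.div_eq_of_lt hd, zero_add]
          rw [truncTerm, truncTerm, e1, multichoose_eq_dworkQuot_mul a (c % p + p * u),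
            multichoose_eq_dworkQuot_mul a (c' + p * (m' - u)), e2, e3]
          simp only [e4 _ _ hcp, e4 _ _ hc'p, hh]
          ring
      rw [hsum]
      -- Here δ = 1: u enters the weights through p * u, which gains one power of p.
      refine dvd_sum_modEq_mul (p : ℤ_[p]) p m' n 1 hp0 _ h (fun M hM c => ih _ m' M hM c) ?_ M
        (by omega) (c / p) _ (by omega) ?_
      · intro N hN u hu v hv huv
        have h1 := pow_dvd_dworkQuot_sub a (Nat.succ_ne_zero N) (i := c % p + p * u)
          (j := c % p + p * v) (by rw [pow_succ']; exact (huv.mul_left' p).add_left _)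
        have h3 : m' - u ≡ m' - v [MOD p ^ N] := by
          refine Nat.ModEq.add_right_cancel huv ?_
          rw [Nat.sub_add_cancel hu, Nat.sub_add_cancel hv]
        have h2 := pow_dvd_dworkQuot_sub a (Nat.succ_ne_zero N) (i := c' + p * (m' - u))
          (j := c' + p * (m' - v)) (by rw [pow_succ']; exact (h3.mul_left' p).add_left _)
        simp only [hh]
        have e : ∀ x y z w : ℤ_[p], x * y - z * w = (x - z) * y + z * (y - w) :=
          fun x y z w => by ring
        rw [e]
        exact dvd_add ((h1.trans (sub_dvd_pow_sub_pow _ _ s)).mul_right _)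
          ((h2.trans (sub_dvd_pow_sub_pow _ _ s)).mul_left _)
      · have := ih (dworkPrime p a) m' M (by omega) (c / p)
        rwa [show n + 1 - (M + 1) + 1 = n - M + 1 by omega]

/-! The embedding of `ℤ_p` into `W` and into `K` -/

theorem zpToW_injective : Function.Injective (zpToW p) :=
  (WittVector.map_injective _ (algebraMap (ZMod p) (AlgebraicClosure (ZMod p))).injective).comp
    (WittVector.equiv p).symm.injective

theorem zpToK_injective : Function.Injective (zpToK p) :=
  (IsFractionRing.injective (W p) (K p)).comp zpToW_injective

theorem zpToK_apply (x : ℤ_[p]) : zpToK p x = algebraMap (W p) (K p) (zpToW p x) := rfl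

theorem zpToW_ne_zero {x : ℤ_[p]} (hx : x ≠ 0) : zpToW p x ≠ 0 :=
  (map_ne_zero_iff _ zpToW_injective).2 hx

theorem pow_dvd_zpToW {x : ℤ_[p]} {n : ℕ} (h : (p : ℤ_[p]) ^ n ∣ x) :
    (p : W p) ^ n ∣ zpToW p x := by
  simpa using map_dvd (zpToW p) h

/-- Frobenius raises Witt coordinates to the p-th power, and those of an element of ℤ_p lie in the
prime field. -/
theorem frobenius_zpToW (x : ℤ_[p]) : WittVector.frobenius (zpToW p x) = zpToW p x := by
  rw [WittVector.frobenius_eq_map_frobenius]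
  ext n
  simp only [zpToW, RingHom.comp_apply, WittVector.map_coeff]
  rw [frobenius_def, ← map_pow, ZMod.pow_card]

theorem frobK_zpToK (x : ℤ_[p]) : frobK p (zpToK p x) = zpToK p x := by
  have : frobK p (zpToK p x) = algebraMap (W p) (K p) (WittVector.frobenius (zpToW p x)) :=
    IsFractionRing.ringEquivOfRingEquiv_algebraMap _ _
  rw [this, frobenius_zpToW, zpToK_apply]

theorem coeff_F (s : ℕ) (a : ℤ_[p]) (k : ℕ) :
    PowerSeries.coeff k (F p s a) = zpToK p (Ring.multichoose a k ^ s) := by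
  rw [F, PowerSeries.coeff_mk, map_pow]
  congr 1
  have h0 : (k.factorial : K p) ≠ 0 := by
    rw [← map_natCast (zpToK p), map_ne_zero_iff _ zpToK_injective]
    exact Nat.cast_ne_zero.2 (Nat.factorial_ne_zero _)
  rw [div_eq_iff h0, ← map_natCast (zpToK p), ← map_mul, mul_comm, factorial_mul_multichoose,
    ← ascPochhammer_map (zpToK p), Polynomial.eval_map_apply]

/-! The powers `c ^ α` -/

/-- Legendre's bound (p - 1) v_p(N!) < N. Taking q = 4 at p = 2 is what leaves powers of p to spare.
-/
theorem exists_q_pow_eq (m : ℕ) : ∃ κ : ℤ_[p],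
    (q p : ℤ_[p]) ^ (m + 1) = (m + 1).factorial * (p * κ) ∧ (m ≠ 0 → (p : ℤ_[p]) ∣ κ) := by
  have hlt := sub_one_mul_padicValNat_factorial_lt_of_ne_zero p (Nat.succ_ne_zero m)
  have hne := Nat.factorial_ne_zero (m + 1)
  obtain ⟨u, hu, hfac⟩ : ∃ u : ℤ_[p], IsUnit u ∧
      ((m + 1).factorial : ℤ_[p]) = p ^ padicValNat p (m + 1).factorial * u := by
    refine ⟨(((m + 1).factorial / p ^ padicValNat p (m + 1).factorial : ℕ) : ℤ_[p]), ?_, ?_⟩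
    · refine isUnit_of_not_dvd fun h => ?_
      rw [dvd_natCast_iff, ← Nat.factorization_def _ hp.out] at h
      exact Nat.not_dvd_ordCompl hp.out hne h
    · rw [← Nat.cast_pow, ← Nat.cast_mul, Nat.mul_div_cancel' pow_padicValNat_dvd]
  set v := padicValNat p (m + 1).factorial
  have hq : (q p : ℤ_[p]) ^ (m + 1) = p ^ (qExp p * (m + 1)) := by
    rw [q, Nat.cast_pow, ← pow_mul]
  have h1 : v + 1 ≤ qExp p * (m + 1) ∧ (m ≠ 0 → v + 2 ≤ qExp p * (m + 1)) := by
    by_cases hp2 : p = 2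
    · have h2 : qExp p = 2 := if_pos hp2
      rw [hp2] at hlt
      rw [h2]
      omega
    · have h2 : qExp p = 1 := if_neg hp2
      have h3 : 2 * v ≤ (p - 1) * v :=
        Nat.mul_le_mul_right v (by have := hp.out.two_le; omega)
      rw [h2]
      omega
  refine ⟨Ring.inverse u * p ^ (qExp p * (m + 1) - (v + 1)), ?_, fun hm => ?_⟩
  · rw [hq, hfac]
    have h2 : (p : ℤ_[p]) ^ (qExp p * (m + 1)) =
        p ^ v * p * p ^ (qExp p * (m + 1) - (v + 1)) := by
      rw [← pow_succ, ← pow_add, Nat.add_sub_cancel' h1.1]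
    rw [h2]
    linear_combination -(p ^ v * p * p ^ (qExp p * (m + 1) - (v + 1)) : ℤ_[p]) *
      Ring.mul_inverse_cancel u hu
  · exact (dvd_pow_self _ (by have := h1.2 hm; omega)).mul_left _

theorem factorial_mul_choose_succ (α : ℤ_[p]) (m : ℕ) :
    ((m + 1).factorial : ℤ_[p]) * Ring.choose α (m + 1) =
      α * ((descPochhammer ℤ_[p] m).comp (Polynomial.X - 1)).eval α := by
  have h := Ring.descPochhammer_eq_factorial_smul_choose α (m + 1)
  rw [nsmul_eq_mul] at h
  rw [← h, ← Polynomial.aeval_eq_smeval, Polynomial.aeval_def, Polynomial.eval₂_eq_eval_map,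
    descPochhammer_map, descPochhammer_succ_left, Polynomial.eval_mul, Polynomial.eval_X]

/-- Each binomial term beyond the first is α times a polynomial in α times (c - 1)^i / i!, and the
last factor absorbs p. -/
theorem exists_binomPartial_eq {c : W p} (hc : (q p : W p) ∣ c - 1) (m : ℕ) :
    ∃ g : ℤ_[p] → W p, (∀ α, binomPartial p c α (m + 1) = 1 + p * zpToW p α * g α) ∧
      ∀ α β, p * zpToW p (α - β) ∣ g α - g β := by
  obtain ⟨d, hd⟩ := hc
  induction m with
  | zero => exact ⟨0, fun α => by simp [binomPartial], fun α β => by simp⟩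
  | succ m ih =>
    obtain ⟨g, hg, hg'⟩ := ih
    obtain ⟨κ, hκ, hκ'⟩ := exists_q_pow_eq (p := p) m
    refine ⟨fun α => g α + zpToW p (((descPochhammer ℤ_[p] m).comp (Polynomial.X - 1)).eval α * κ) *
      d ^ (m + 1), fun α => ?_, fun α β => ?_⟩
    · have h1 : Ring.choose α (m + 1) * (q p : ℤ_[p]) ^ (m + 1) =
          p * α * (((descPochhammer ℤ_[p] m).comp (Polynomial.X - 1)).eval α * κ) := by
        rw [hκ]
        linear_combination (p * κ) * factorial_mul_choose_succ α m
      have h2 := congrArg (zpToW p) h1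
      have h3 := hg α
      simp only [map_mul, map_pow, map_natCast] at h2 ⊢
      unfold binomPartial at h3 ⊢
      rw [Finset.sum_range_succ, h3, hd, mul_pow]
      linear_combination d ^ (m + 1) * h2
    · have h1 : (p : ℤ_[p]) * (α - β) ∣
          (((descPochhammer ℤ_[p] m).comp (Polynomial.X - 1)).eval α -
            ((descPochhammer ℤ_[p] m).comp (Polynomial.X - 1)).eval β) * κ := by
        -- For m = 0 the polynomial is constant, so the missing second factor of p is not needed.
        by_cases hm : m = 0
        · subst hm; simp
        · rw [mul_comm (p : ℤ_[p])]
          exact mul_dvd_mul (Polynomial.sub_dvd_eval_sub _ _ _) (hκ' hm)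
      have h2 := map_dvd (zpToW p) h1
      rw [map_mul, map_natCast] at h2
      have h3 := dvd_add (hg' α β) (h2.mul_right (d ^ (m + 1)))
      convert h3 using 1
      simp only [map_mul, map_sub]
      ring

theorem p_dvd_of_q_dvd {x : W p} (h : (q p : W p) ∣ x) : (p : W p) ∣ x := by
  refine Dvd.dvd.trans ?_ h
  rw [q, Nat.cast_pow]
  exact dvd_pow_self _ (by unfold qExp; split_ifs <;> simp)

theorem exists_padicPow_eq {c : W p} (hc : (q p : W p) ∣ c - 1) {α : ℤ_[p]} (hα : α ≠ 0) :
    ∃ γ, padicPow p c α = 1 + p * zpToW p α * γ := by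
  obtain ⟨r, u, hu, hαu⟩ := exists_eq_pow_mul_isUnit hα
  obtain ⟨N, hN⟩ := padicPow_spec p (p_dvd_of_q_dvd hc) α (r + 1)
  obtain ⟨g, hg, -⟩ := exists_binomPartial_eq hc N
  obtain ⟨y, hy⟩ := hN (N + 1) N.le_succ
  rw [hg] at hy
  have h1 : (p : ℤ_[p]) ^ (r + 1) = p * α * Ring.inverse u := by
    rw [hαu]
    linear_combination -(p : ℤ_[p]) ^ (r + 1) * Ring.mul_inverse_cancel u hu
  have h2 := congrArg (zpToW p) h1
  simp only [map_mul, map_pow, map_natCast] at h2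
  exact ⟨g α - zpToW p (Ring.inverse u) * y, by linear_combination -hy - y * h2⟩

/-- Passes the property of partial sums to the limit. Dividing by p α costs v(α) + 1 digits, so the
approximation is taken that much finer. -/
theorem pow_dvd_of_padicPow_eq {c : W p} (hc : (q p : W p) ∣ c - 1) {α β : ℤ_[p]} (hα : α ≠ 0)
    (hβ : β ≠ 0) {n : ℕ} (h : (p : ℤ_[p]) ^ n ∣ α - β) {γ δ : W p}
    (hγ : padicPow p c α = 1 + p * zpToW p α * γ) (hδ : padicPow p c β = 1 + p * zpToW p β * δ) :
    (p : W p) ^ (n + 1) ∣ γ - δ := by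
  have hp0 : (p : W p) ≠ 0 := by
    simpa using zpToW_ne_zero (natCast_p_ne_zero (p := p))
  have key : ∀ {α : ℤ_[p]} {γ : W p}, α ≠ 0 → padicPow p c α = 1 + p * zpToW p α * γ →
      ∃ N, ∀ m ≥ N, ∀ g, binomPartial p c α (m + 1) = 1 + p * zpToW p α * g →
        (p : W p) ^ (n + 1) ∣ g - γ := by
    intro α γ hα hγ
    obtain ⟨r, u, hu, hαu⟩ := exists_eq_pow_mul_isUnit hα
    obtain ⟨N, hN⟩ := padicPow_spec p (p_dvd_of_q_dvd hc) α (r + 1 + (n + 1))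
    refine ⟨N, fun m hm g hg => ?_⟩
    have h1 := hN (m + 1) (by omega)
    rw [hg, hγ] at h1
    have h2 : 1 + p * zpToW p α * g - (1 + p * zpToW p α * γ) =
        p ^ (r + 1) * (zpToW p u * (g - γ)) := by
      rw [hαu]
      simp only [map_mul, map_pow, map_natCast]
      ring
    rwa [h2, pow_add _ (r + 1), mul_dvd_mul_iff_left (pow_ne_zero _ hp0),
      (hu.map (zpToW p)).dvd_mul_left] at h1
  obtain ⟨N₁, h₁⟩ := key hα hγ
  obtain ⟨N₂, h₂⟩ := key hβ hδ
  obtain ⟨g, hg, hg'⟩ := exists_binomPartial_eq hc (max N₁ N₂)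
  have h3 : (p : W p) ^ (n + 1) ∣ g α - g β := by
    refine Dvd.dvd.trans ?_ (hg' α β)
    rw [pow_succ']
    exact mul_dvd_mul_left _ (pow_dvd_zpToW h)
  have h4 := dvd_add (dvd_sub h3 (h₁ _ (le_max_left _ _) _ (hg α))) (h₂ _ (le_max_right _ _) _ (hg β))
  convert h4 using 1
  ring

/-! Elements `1 + x b` and `1 + x' b'` of a ring with `b` and `b'` congruent -/

section LipPair

variable {R : Type*} [CommRing R]

/-- `g = 1 + x b` and `g' = 1 + x' b'` with `b' ≡ b` modulo `π`. -/
def LipPair (π x x' g g' : R) : Prop :=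
  ∃ b b', g = 1 + x * b ∧ g' = 1 + x' * b' ∧ π ∣ b' - b

theorem LipPair.mul {π x x' g g' h h' : R} (hx : π ∣ x' - x) (hg : LipPair π x x' g g')
    (hh : LipPair π x x' h h') : LipPair π x x' (g * h) (g' * h') := by
  obtain ⟨b, b', rfl, rfl, t, ht⟩ := hg
  obtain ⟨d, d', rfl, rfl, u, hu⟩ := hh
  obtain ⟨v, hv⟩ := hx
  exact ⟨b + d + x * b * d, b' + d' + x' * b' * d', by ring, by ring,
    t + u + v * b' * d' + x * t * d' + x * b * u,
    by linear_combination ht + hu + b' * d' * hv + x * d' * ht + x * b * hu⟩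

theorem LipPair.pow {π x x' g g' : R} (hx : π ∣ x' - x) (hg : LipPair π x x' g g') (s : ℕ) :
    LipPair π x x' (g ^ s) (g' ^ s) := by
  induction s with
  | zero => exact ⟨0, 0, by simp, by simp, by simp⟩
  | succ s ih => simpa only [pow_succ] using ih.mul hx hg

theorem LipPair.inv {π x x' g g' h h' : R} (hx : π ∣ x' - x) (hg : LipPair π x x' g g')
    (h1 : g * h = 1) (h1' : g' * h' = 1) : LipPair π x x' h h' := by
  obtain ⟨b, b', rfl, rfl, t, ht⟩ := hg
  obtain ⟨v, hv⟩ := hx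
  refine ⟨-(b * h), -(b' * h'), by linear_combination h1, by linear_combination h1',
    -(t * h') + b * (h * h' * (v * b' + x * t)), ?_⟩
  linear_combination -h' * ht + b * h * h' * (b' * hv + x * ht) + b * h' * h1 - b * h * h1'

end LipPair

/-! The coefficients of `Ghat` -/

/-- The numerator of `(a + k)⁻¹ * (1 - gammaQuot a k ^ (-s) * c ^ ((a + k) / p))`, the second term
being present only if `p` divides `a + k`. -/
def ghatNum (s : ℕ) (a : ℤ_[p]) (c : W p) (k : ℕ) : W p :=
  if k % p = negResidue p a 1 then
    1 - zpToW p (Ring.inverse (gammaQuot p a k)) ^ s * padicPow p c (dworkPrime p a + (k / p : ℕ))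
  else 1

theorem add_natCast_ne_zero {a : ℤ_[p]} (ha : ∀ m : ℕ, a ≠ -(m : ℤ_[p])) (k : ℕ) : a + k ≠ 0 :=
  fun h => ha k (eq_neg_of_add_eq_zero_left h)

theorem lipPair_inv_gammaQuot_pow_mul_padicPow (s : ℕ) {a : ℤ_[p]}
    (ha : ∀ m : ℕ, a ≠ -(m : ℤ_[p])) {c : W p} (hc : (q p : W p) ∣ c - 1) {k n : ℕ} (hn : n ≠ 0)
    (hk : k % p = negResidue p a 1) :
    LipPair ((p : W p) ^ n) (zpToW p (a + k)) (zpToW p (a + (k + p ^ n : ℕ)))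
      (zpToW p (Ring.inverse (gammaQuot p a k)) ^ s *
        padicPow p c (dworkPrime p a + (k / p : ℕ)))
      (zpToW p (Ring.inverse (gammaQuot p a (k + p ^ n))) ^ s *
        padicPow p c (dworkPrime p a + ((k + p ^ n) / p : ℕ))) := by
  obtain ⟨j, rfl⟩ : ∃ j, n = j + 1 := ⟨n - 1, by omega⟩
  have hmod : (k + p ^ (j + 1)) % p = negResidue p a 1 := by
    rw [pow_succ, mul_comm, Nat.add_mul_mod_self_left, hk]
  have hdiv : (k + p ^ (j + 1)) / p = k / p + p ^ j := by
    rw [pow_succ, mul_comm, Nat.add_mul_div_left _ _ hp.out.pos]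
  have hx : (p : W p) ^ (j + 1) ∣ zpToW p (a + (k + p ^ (j + 1) : ℕ)) - zpToW p (a + k) := by
    rw [← map_sub]
    exact pow_dvd_zpToW ⟨1, by push_cast; ring⟩
  have hxk := add_natCast_ne_zero ha k
  have hxk' := add_natCast_ne_zero ha (k + p ^ (j + 1))
  refine LipPair.mul hx (LipPair.pow hx (LipPair.inv hx
    (g := zpToW p (gammaQuot p a k)) (g' := zpToW p (gammaQuot p a (k + p ^ (j + 1)))) ?_ ?_ ?_) s)
    ?_
  · obtain ⟨b, hb⟩ := exists_gammaQuot_eq ((dvd_add_natCast_iff a k).2 hk)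
    obtain ⟨b', hb'⟩ := exists_gammaQuot_eq ((dvd_add_natCast_iff a _).2 hmod)
    refine ⟨zpToW p b, zpToW p b', by rw [hb]; simp, by rw [hb']; simp, ?_⟩
    rw [← map_sub]
    have hcast : a + ((k + p ^ (j + 1) : ℕ) : ℤ_[p]) = a + k + p ^ (j + 1) := by push_cast; ring
    rw [hcast] at hb' hxk'
    exact pow_dvd_zpToW (pow_dvd_of_gammaQuot_eq hn ((dvd_add_natCast_iff a k).2 hk) hxk hxk' hb hb')
  · rw [← map_mul, Ring.mul_inverse_cancel _ (isUnit_gammaQuot a k), map_one]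
  · rw [← map_mul, Ring.mul_inverse_cancel _ (isUnit_gammaQuot a _), map_one]
  · have e := add_natCast_eq_mul hk
    have e' := add_natCast_eq_mul hmod
    have hα : dworkPrime p a + (k / p : ℕ) ≠ 0 := fun h => hxk (by rw [e, h, mul_zero])
    have hα' : dworkPrime p a + ((k + p ^ (j + 1)) / p : ℕ) ≠ 0 :=
      fun h => hxk' (by rw [e', h, mul_zero])
    obtain ⟨γ, hγ⟩ := exists_padicPow_eq hc hα
    obtain ⟨γ', hγ'⟩ := exists_padicPow_eq hc hα'
    refine ⟨γ, γ', by rw [hγ, e]; simp, by rw [hγ', e']; simp, ?_⟩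
    -- The exponents (a + k)/p differ only by p^j; the spare factor of p in that lemma restores
    -- p^(j+1).
    refine pow_dvd_of_padicPow_eq hc hα' hα ?_ hγ' hγ
    exact ⟨1, by rw [hdiv]; push_cast; ring⟩

theorem exists_mul_eq_ghatNum (s : ℕ) {a : ℤ_[p]} (ha : ∀ m : ℕ, a ≠ -(m : ℤ_[p])) {c : W p}
    (hc : (q p : W p) ∣ c - 1) (k : ℕ) : ∃ β, zpToW p (a + k) * β = ghatNum s a c k := by
  unfold ghatNum
  split_ifs with hk
  · obtain ⟨b, -, hb, -, -⟩ := lipPair_inv_gammaQuot_pow_mul_padicPow s ha hc one_ne_zero hk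
    exact ⟨-b, by rw [hb]; ring⟩
  · have hu := (isUnit_of_not_dvd (mt (dvd_add_natCast_iff a k).1 hk)).map (zpToW p)
    exact ⟨Ring.inverse (zpToW p (a + k)), Ring.mul_inverse_cancel _ hu⟩

theorem pow_dvd_of_mul_eq_ghatNum (s : ℕ) {a : ℤ_[p]} (ha : ∀ m : ℕ, a ≠ -(m : ℤ_[p])) {c : W p}
    (hc : (q p : W p) ∣ c - 1) (k n : ℕ) {β β' : W p}
    (hβ : zpToW p (a + k) * β = ghatNum s a c k)
    (hβ' : zpToW p (a + (k + p ^ n : ℕ)) * β' = ghatNum s a c (k + p ^ n)) :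
    (p : W p) ^ n ∣ β' - β := by
  rcases eq_or_ne n 0 with rfl | hn
  · simp
  have hmod : (k + p ^ n) % p = k % p := by
    obtain ⟨v, hv⟩ := dvd_pow_self p hn
    rw [hv, Nat.add_mul_mod_self_left]
  unfold ghatNum at hβ hβ'
  rw [hmod] at hβ'
  split_ifs at hβ hβ' with hk
  · obtain ⟨b, b', hb, hb', hbb⟩ := lipPair_inv_gammaQuot_pow_mul_padicPow s ha hc hn hk
    rw [hb] at hβ
    rw [hb'] at hβ'
    obtain rfl : β = -b := mul_left_cancel₀ (zpToW_ne_zero (add_natCast_ne_zero ha k))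
      (by linear_combination hβ)
    obtain rfl : β' = -b' := mul_left_cancel₀ (zpToW_ne_zero (add_natCast_ne_zero ha _))
      (by linear_combination hβ')
    rw [← neg_sub', dvd_neg]
    exact hbb
  · have hx : (p : W p) ^ n ∣ zpToW p (a + k) - zpToW p (a + (k + p ^ n : ℕ)) := by
      rw [← map_sub]
      exact pow_dvd_zpToW ⟨-1, by push_cast; ring⟩
    have : β' - β = (zpToW p (a + k) - zpToW p (a + (k + p ^ n : ℕ))) * (β * β') := by
      linear_combination β * hβ' - β' * hβ
    rw [this]
    exact hx.mul_right _

/-- If p divides a + k, then `dworkQuot` has no factor p, so the Frobenius term (-1)^(se) A'_⌊k/p⌋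
equals A_k g_k^(-s) and A_k can be factored out. -/
theorem coeff_Ghat (s : ℕ) {a : ℤ_[p]} (ha : ∀ m : ℕ, a ≠ -(m : ℤ_[p])) (c : W p) (k : ℕ) {β : W p}
    (hβ : zpToW p (a + k) * β = ghatNum s a c k) :
    PowerSeries.coeff k (Ghat p s a c) =
      algebraMap (W p) (K p) (zpToW p (Ring.multichoose a k ^ s) * β) := by
  have hx0 : zpToK p (a + k) ≠ 0 := (map_ne_zero_iff _ zpToK_injective).2 (add_natCast_ne_zero ha k)
  have hint : integrand p s a c (a + k) =
      algebraMap (W p) (K p) (zpToW p (Ring.multichoose a k ^ s) * ghatNum s a c k) := by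
    have h1 : mulSym p a (toSym p (F p s a)) (a + k) = zpToK p (Ring.multichoose a k ^ s) := by
      rw [mulSym, add_sub_cancel_left, toSym_natCast, coeff_F]
    rw [integrand, Pi.sub_apply, Pi.smul_apply, h1, smul_eq_mul]
    unfold ghatNum
    split_ifs with hk
    · have h2 : sigma p c (mulSym p (dworkPrime p a) (toSym p (F p s (dworkPrime p a)))) (a + k) =
          zpToK p (Ring.multichoose (dworkPrime p a) (k / p) ^ s) *
            algebraMap (W p) (K p) (padicPow p c (dworkPrime p a + (k / p : ℕ))) := by
        rw [add_natCast_eq_mul hk, sigma, (mul_right_injective₀ natCast_p_ne_zero).extend_apply,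
          mulSym, add_sub_cancel_left, toSym_natCast, coeff_F, frobK_zpToK]
      have h3 : (-1) ^ (s * e p a) * Ring.multichoose (dworkPrime p a) (k / p) ^ s =
          Ring.multichoose a k ^ s * Ring.inverse (gammaQuot p a k) ^ s := by
        rw [mul_comm s, pow_mul, ← mul_pow, ← mul_pow]
        congr 1
        rw [multichoose_eq_dworkQuot_mul a k, dworkQuot, if_pos hk.le, mul_one]
        have h4 := Ring.mul_inverse_cancel _ (isUnit_gammaQuot a k)
        have h5 : ((-1) ^ e p a * (-1) ^ e p a : ℤ_[p]) = 1 := by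
          rw [← mul_pow]; simp
        rw [gammaQuot] at h4 ⊢
        linear_combination -((-1) ^ e p a * Ring.multichoose (dworkPrime p a) (k / p)) * h4 +
          (unitProd p a k * Ring.inverse (unitProd p 1 k) *
            Ring.multichoose (dworkPrime p a) (k / p) *
            Ring.inverse ((-1) ^ e p a * (unitProd p a k * Ring.inverse (unitProd p 1 k)))) * h5
      have h6 := congrArg (zpToK p) h3
      rw [h2]
      simp only [map_mul, map_pow, map_neg, map_one, map_sub, ← zpToK_apply] at h6 ⊢
      linear_combination -algebraMap (W p) (K p) (padicPow p c (dworkPrime p a + (k / p : ℕ))) * h6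
    · have h2 : sigma p c (mulSym p (dworkPrime p a) (toSym p (F p s (dworkPrime p a)))) (a + k) =
          0 := Function.extend_apply' _ _ _ fun ⟨α, hα⟩ =>
            hk ((dvd_add_natCast_iff a k).1 ⟨α, hα.symm⟩)
      rw [h2, mul_zero, sub_zero, mul_one, ← zpToK_apply]
  rw [Ghat, PowerSeries.coeff_mk, ghatSym, mulSym, integral, sub_neg_eq_add, add_comm (k : ℤ_[p]),
    hint, div_eq_iff hx0, zpToK_apply, ← map_mul, ← hβ]
  congr 1
  ring

/-! The congruence -/

theorem coeff_toK (f : (W p)⟦X⟧) (k : ℕ) :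
    PowerSeries.coeff k (toK p f) = algebraMap (W p) (K p) (PowerSeries.coeff k f) :=
  PowerSeries.coeff_map _ _ _

theorem truncLT_toK (m : ℕ) (f : (W p)⟦X⟧) :
    truncLT p m (toK p f) = toK p (PowerSeries.trunc m f : Polynomial (W p)) := by
  ext k
  rw [coeff_toK, truncLT, Polynomial.coeff_coe, Polynomial.coeff_coe, PowerSeries.coeff_trunc,
    PowerSeries.coeff_trunc, coeff_toK]
  split_ifs <;> simp

theorem coeff_mul_trunc_sub (A β : ℕ → W p) (N m : ℕ) :
    PowerSeries.coeff m
      (PowerSeries.mk (fun k => A k * β k) *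
        ((PowerSeries.trunc N (PowerSeries.mk A) : Polynomial (W p)) : (W p)⟦X⟧) -
      ((PowerSeries.trunc N (PowerSeries.mk fun k => A k * β k) : Polynomial (W p)) : (W p)⟦X⟧) *
        PowerSeries.mk A) =
    ∑ i ∈ Finset.range (m + 1), β i *
      (A i * A (m - i) * ((if m - i < N then 1 else 0) - if i < N then 1 else 0)) := by
  rw [map_sub, PowerSeries.coeff_mul, PowerSeries.coeff_mul,
    Finset.Nat.sum_antidiagonal_eq_sum_range_succ_mk,
    Finset.Nat.sum_antidiagonal_eq_sum_range_succ_mk, ← Finset.sum_sub_distrib]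
  refine Finset.sum_congr rfl fun i _ => ?_
  simp only [PowerSeries.coeff_mk, Polynomial.coeff_coe, PowerSeries.coeff_trunc]
  split_ifs <;> ring

theorem exists_inv_of_constantCoeff_eq_one {f : (W p)⟦X⟧} (hf : PowerSeries.coeff 0 f = 1) :
    ∃ g, toK p g = (toK p f)⁻¹ := by
  obtain ⟨g, hg⟩ := (PowerSeries.isUnit_iff_constantCoeff.2
    (by rw [← PowerSeries.coeff_zero_eq_constantCoeff_apply, hf]; exact isUnit_one)).exists_right_inv
    (a := f)
  refine ⟨g, ?_⟩
  rw [PowerSeries.eq_inv_iff_mul_eq_one, ← map_mul, mul_comm, hg, map_one]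
  rw [← PowerSeries.coeff_zero_eq_constantCoeff_apply, coeff_toK, hf, map_one]
  exact one_ne_zero

theorem exists_eq_pow_mul {f : (W p)⟦X⟧} {n : ℕ}
    (h : ∀ m, (p : W p) ^ n ∣ PowerSeries.coeff m f) : ∃ g, f = (p : (W p)⟦X⟧) ^ n * g := by
  choose g hg using h
  refine ⟨PowerSeries.mk g, ?_⟩
  ext m
  have : ((p : (W p)⟦X⟧)) ^ n = PowerSeries.C ((p : W p) ^ n) := by simp
  rw [this, PowerSeries.coeff_C_mul, PowerSeries.coeff_mk, hg]

end PadicHG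

end

theorem theorem3p1 (p : ℕ) [Fact p.Prime] (s : ℕ) (hs : 1 ≤ s) (a : ℤ_[p])
    (ha : ∀ m : ℕ, a ≠ -(m : ℤ_[p])) (c : PadicHG.W p)
    (hc : (PadicHG.q p : PadicHG.W p) ∣ c - 1) :
    (∃ G : PowerSeries (PadicHG.W p), PadicHG.toK p G = PadicHG.Ghat p s a c) ∧
    (∃ H : PowerSeries (PadicHG.W p), PadicHG.toK p H = PadicHG.Fhat p s a c) ∧
    ∀ n : ℕ, PadicHG.CongrModPow p n (PadicHG.Fhat p s a c)
      (PadicHG.truncLT p (p ^ n) (PadicHG.Ghat p s a c) *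
        (PadicHG.truncLT p (p ^ n) (PadicHG.F p s a))⁻¹) := by
  open PadicHG in
  choose β hβ using exists_mul_eq_ghatNum s ha hc
  set A : ℕ → W p := fun k => zpToW p (Ring.multichoose a k ^ s) with hA
  have hF : toK p (PowerSeries.mk A) = F p s a := by
    ext k
    rw [coeff_toK, PowerSeries.coeff_mk, coeff_F, zpToK_apply]
  have hG : toK p (PowerSeries.mk fun k => A k * β k) = Ghat p s a c := by
    ext k
    rw [coeff_toK, PowerSeries.coeff_mk, coeff_Ghat s ha c k (hβ k)]
  have hA0 : A 0 = 1 := by simp [hA]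
  obtain ⟨I, hI⟩ := exists_inv_of_constantCoeff_eq_one (f := PowerSeries.mk A) (by simpa using hA0)
  refine ⟨⟨_, hG⟩, ⟨PowerSeries.mk (fun k => A k * β k) * I, ?_⟩, fun n => ?_⟩
  · rw [map_mul, hG, hI, hF, Fhat]
  have hpn : 0 < p ^ n := pow_pos (Fact.out : p.Prime).pos n
  have hT0 : PowerSeries.coeff 0 ((PowerSeries.trunc (p ^ n) (PowerSeries.mk A) :
      Polynomial (W p)) : PowerSeries (W p)) = 1 := by
    rw [Polynomial.coeff_coe, PowerSeries.coeff_trunc, if_pos hpn, PowerSeries.coeff_mk, hA0]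
  obtain ⟨J, hJ⟩ := exists_inv_of_constantCoeff_eq_one hT0
  obtain ⟨g, hg⟩ := exists_eq_pow_mul (n := n) fun m => by
    rw [coeff_mul_trunc_sub A β (p ^ n) m]
    have hp0 := (Fact.out : p.Prime).pos
    have hw : ∀ i, A i * A (m - i) *
        ((if m - i < p ^ n then 1 else 0) - if i < p ^ n then 1 else 0) =
        zpToW p (truncTerm s a n m i) := fun i => by
      simp only [hA, truncTerm, map_mul, map_sub, apply_ite (zpToW p), map_one, map_zero]
    simp only [hw]
    -- Applied to the single class modulo p^0: the total weight is zero, so only the variation of β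
    -- contributes.
    have := dvd_sum_modEq_mul (p : W p) p m n 0 hp0 (fun i => zpToW p (truncTerm s a n m i)) β
      (fun M hM d => by
        simp only [← map_sum]
        exact pow_dvd_zpToW (pow_dvd_sum_truncTerm s n a m M hM d))
      (fun M _ i _ j _ hij => dvd_sub_of_modEq_of_forall_dvd_add_sub _ β _
        (fun k => pow_dvd_of_mul_eq_ghatNum s ha hc k M (hβ k) (hβ _)) hij)
      0 (Nat.zero_le _) 0 n le_rfl (by simp [Nat.modEq_one, ← map_sum, sum_truncTerm])
    simpa [Nat.modEq_one] using this
  -- `I` and `J` invert F and its truncation over W, so multiplying by them preserves divisibility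
  -- by p^n.
  refine ⟨I * J * g, ?_⟩
  have hIF : toK p (PowerSeries.mk A) * toK p I = 1 := by
    rw [hI]
    refine PowerSeries.mul_inv_cancel _ ?_
    rw [← PowerSeries.coeff_zero_eq_constantCoeff_apply, coeff_toK, PowerSeries.coeff_mk, hA0,
      map_one]
    exact one_ne_zero
  have hJT : toK p (PowerSeries.trunc (p ^ n) (PowerSeries.mk A) : Polynomial (W p)) *
      toK p J = 1 := by
    rw [hJ]
    refine PowerSeries.mul_inv_cancel _ ?_
    rw [← PowerSeries.coeff_zero_eq_constantCoeff_apply, coeff_toK, hT0, map_one]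
    exact one_ne_zero
  have hg' := congrArg (toK p) hg
  rw [Fhat, ← hF, ← hG, truncLT_toK, truncLT_toK, ← hI, ← hJ]
  simp only [map_mul, map_sub] at hg' ⊢
  linear_combination toK p I * toK p J * hg' -
    toK p (PowerSeries.mk fun k => A k * β k) * toK p I * hJT +
    toK p (PowerSeries.trunc (p ^ n) (PowerSeries.mk fun k => A k * β k) : Polynomial (W p)) *
      toK p J * hIF
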